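/- Let $p$ be a prime number and let $G$ be a finite $p$-group of nilpotency class $3$. An automorphism $\alpha$ of a group $K$ is called intense if for every subgroup $H$ of $K$ there is $g\in K$ with $\alpha(H)=gHg^{-1}$; the intense automorphisms of $K$ form a group $\mathrm{Int}(K)$. Let $\Phi(G)=[G,G]G^p$ be the Frattini subgroup of $G$. Every $\alpha\in\mathrm{Int}(G)$ acts on the non-zero $\mathbb{F}_p$-vector space $G/\Phi(G)$ as multiplication by a scalar $\mu(\alpha)\in\mathbb{F}_p^*$; the intense character of $G$ is the homomorphism $\chi_G=\omega\circ\mu:\mathrm{Int}(G)\to\mathbb{Z}_p^*$, where $\omega:\mathbb{F}_p^*\to\mathbb{Z}_p^*$ is the Teichmüller character. The intensity of $G$ is the index $\mathrm{int}(G)=|\mathrm{Int}(G):\ker\chi_G|$. Let $G_2=[G,G]$. Then the following are equivalent. 1. One has $\mathrm{int}(G)>1$. 2. The prime $p$ is odd and $\mathrm{int}(G)=2$. 3. The prime $p$ is odd and $|G:G_2|=p^2$. -/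

import Mathlib

/-- An automorphism `α` of a group `G` is intense if for every subgroup `H` of `G` there is
`g : G` with `α(H) = gHg⁻¹`. -/
def IsIntense {G : Type*} [Group G] (α : MulAut G) : Prop :=
  ∀ H : Subgroup G, ∃ g : G, H.map α.toMonoidHom = H.map (MulAut.conj g).toMonoidHom

/-- The group `Int(G)` of intense automorphisms of `G`. -/
def intenseAut (G : Type*) [Group G] : Subgroup (MulAut G) where
  carrier := {α | IsIntense α}
  one_mem' H := ⟨1, by simp⟩
  mul_mem' {α β} hα hβ H := by
    obtain ⟨g, hg⟩ := hβ H
    obtain ⟨k, hk⟩ := hα H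
    refine ⟨α g * k, ?_⟩
    have h1 : H.map (α * β).toMonoidHom = (H.map β.toMonoidHom).map α.toMonoidHom := by
      rw [Subgroup.map_map]; rfl
    have h2 : (H.map (MulAut.conj g).toMonoidHom).map α.toMonoidHom
        = (H.map α.toMonoidHom).map (MulAut.conj (α g)).toMonoidHom := by
      rw [Subgroup.map_map, Subgroup.map_map]
      congr 1
      ext x
      simp
    rw [h1, hg, h2, hk, Subgroup.map_map]
    congr 1
    ext x
    simp [mul_assoc]
  inv_mem' {α} hα H := by
    obtain ⟨g, hg⟩ := hα (H.map (α⁻¹).toMonoidHom)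
    refine ⟨g⁻¹, ?_⟩
    have h1 : (H.map (α⁻¹).toMonoidHom).map α.toMonoidHom = H := by
      rw [Subgroup.map_map]
      convert Subgroup.map_id H
      ext x
      simp
    rw [h1] at hg
    have h2 : ((H.map (α⁻¹).toMonoidHom).map (MulAut.conj g).toMonoidHom).map
        (MulAut.conj g⁻¹).toMonoidHom = H.map (α⁻¹).toMonoidHom := by
      rw [Subgroup.map_map]
      convert Subgroup.map_id _
      ext x
      simp [mul_assoc]
    rw [← h2, ← hg]

/-- An intense automorphism maps each normal subgroup onto itself. -/
theorem intenseAut_map_normal {G : Type*} [Group G] (N : Subgroup G) [hN : N.Normal]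
    (α : intenseAut G) : N.map (α : MulAut G).toMonoidHom = N := by
  obtain ⟨g, hg⟩ := α.2 N
  rw [hg]
  ext x
  simp only [Subgroup.mem_map]
  constructor
  · rintro ⟨y, hy, rfl⟩
    exact hN.conj_mem y hy g
  · intro hx
    refine ⟨g⁻¹ * x * g, ?_, by simp [mul_assoc]⟩
    simpa using hN.conj_mem x hx g⁻¹

/-- The automorphism `xN ↦ α(x)N` of `G ⧸ N` induced by an intense automorphism `α` of `G`. -/
def intenseQuotientAut {G : Type*} [Group G] (N : Subgroup G) [N.Normal] (α : intenseAut G) :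
    MulAut (G ⧸ N) :=
  QuotientGroup.congr N N (α : MulAut G) (intenseAut_map_normal N α)

theorem intenseQuotientAut_mk {G : Type*} [Group G] (N : Subgroup G) [N.Normal]
    (α : intenseAut G) (x : G) :
    intenseQuotientAut N α (x : G ⧸ N) = (((α : MulAut G) x : G) : G ⧸ N) := rfl

theorem isIntense_intenseQuotientAut {G : Type*} [Group G] (N : Subgroup G) [N.Normal]
    (α : intenseAut G) : IsIntense (intenseQuotientAut N α) := by
  intro H
  obtain ⟨g, hg⟩ := α.2 (H.comap (QuotientGroup.mk' N))
  refine ⟨(g : G ⧸ N), ?_⟩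
  have hH : (H.comap (QuotientGroup.mk' N)).map (QuotientGroup.mk' N) = H :=
    Subgroup.map_comap_eq_self_of_surjective (QuotientGroup.mk'_surjective N) H
  have h := congrArg (Subgroup.map (QuotientGroup.mk' N)) hg
  rw [← hH, Subgroup.map_map, Subgroup.map_map]
  rw [Subgroup.map_map, Subgroup.map_map] at h
  exact h

/-- The homomorphism `Int(G) → Int(G ⧸ N)` induced by the projection `G → G ⧸ N`. -/
def intenseAutQuotient {G : Type*} [Group G] (N : Subgroup G) [N.Normal] :
    intenseAut G →* intenseAut (G ⧸ N) where
  toFun α := ⟨intenseQuotientAut N α, isIntense_intenseQuotientAut N α⟩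
  map_one' := by
    ext x
    obtain ⟨x, rfl⟩ := QuotientGroup.mk_surjective x
    rfl
  map_mul' α β := by
    ext x
    obtain ⟨x, rfl⟩ := QuotientGroup.mk_surjective x
    rfl

/-- In an elementary abelian `p`-group (an `𝔽_p`-vector space, written multiplicatively) every
intense automorphism is multiplication by a scalar of `𝔽_pˣ`. -/
theorem exists_intense_scalar (p : ℕ) [Fact p.Prime] {V : Type*} [Group V]
    (hc : ∀ v w : V, v * w = w * v) (he : ∀ v : V, v ^ p = 1) (α : intenseAut V) :
    ∃ m : (ZMod p)ˣ, ∀ v : V, (α : MulAut V) v = v ^ (m : ZMod p).val := by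
  let _ : CommGroup V := { (inferInstance : Group V) with mul_comm := hc }
  let _ : Module (ZMod p) (Additive V) :=
    AddCommGroup.zmodModule (n := p) (fun v => congrArg Additive.ofMul (he v.toMul))
  have hsm : ∀ (a : ZMod p) (v : V), a • Additive.ofMul v = Additive.ofMul (v ^ a.val) := by
    intro a v
    conv_lhs => rw [← ZMod.natCast_zmod_val a]
    rw [Nat.cast_smul_eq_nsmul]
    rfl
  let f : Additive V →+ Additive V := MonoidHom.toAdditive (α : MulAut V).toMonoidHom
  have hf : ∀ v : V, f (Additive.ofMul v) = Additive.ofMul ((α : MulAut V) v) := fun _ => rfl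
  have key : ∀ v, ¬ LinearIndependent (ZMod p) ![v, f.toZModLinearMap p v] := by
    intro v hli
    have hN := intenseAut_map_normal (Subgroup.zpowers v.toMul) α
    have hv : (α : MulAut V) v.toMul ∈ Subgroup.zpowers v.toMul := by
      rw [← hN]
      exact Subgroup.mem_map_of_mem _ (Subgroup.mem_zpowers _)
    obtain ⟨k, hk⟩ := Subgroup.mem_zpowers_iff.mp hv
    have h2 := LinearIndependent.pair_iff.mp hli (k : ZMod p) (-1) (by
      rw [Int.cast_smul_eq_zsmul]
      have : f v = k • v := by
        apply Additive.toMul.injective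
        exact hk.symm
      simp [this])
    simp at h2
  obtain ⟨a, ha⟩ := LinearMap.exists_eq_smul_id_of_forall_notLinearIndependent key
  have hval : ∀ v : V, (α : MulAut V) v = v ^ a.val := by
    intro v
    have := LinearMap.congr_fun ha (Additive.ofMul v)
    have h3 : f (Additive.ofMul v) = a • Additive.ofMul v := this
    rw [hf, hsm] at h3
    exact Additive.ofMul.injective h3
  by_cases h0 : a = 0
  · refine ⟨1, fun v => ?_⟩
    have h1 : ∀ w : V, w = 1 := by
      intro w
      apply (α : MulAut V).injective
      rw [hval w, h0]
      simp
    rw [h1 ((α : MulAut V) v), h1 v, one_pow]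
  · exact ⟨Units.mk0 a h0, hval⟩

open Classical in
/-- The scalar in `𝔽_pˣ` by which an intense automorphism acts on an elementary abelian `p`-group,
with value `1` on the trivial group. -/
noncomputable def intenseScalar (p : ℕ) [Fact p.Prime] {V : Type*} [Group V]
    (hc : ∀ v w : V, v * w = w * v) (he : ∀ v : V, v ^ p = 1) (α : intenseAut V) : (ZMod p)ˣ :=
  if Nontrivial V then (exists_intense_scalar p hc he α).choose else 1

theorem intenseScalar_spec (p : ℕ) [Fact p.Prime] {V : Type*} [Group V]
    (hc : ∀ v w : V, v * w = w * v) (he : ∀ v : V, v ^ p = 1) (α : intenseAut V) (v : V) :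
    (α : MulAut V) v = v ^ (intenseScalar p hc he α : ZMod p).val := by
  unfold intenseScalar
  split_ifs with h
  · exact (exists_intense_scalar p hc he α).choose_spec v
  · rw [not_nontrivial_iff_subsingleton] at h
    exact Subsingleton.elim _ _

theorem intenseScalar_unique (p : ℕ) [Fact p.Prime] {V : Type*} [Group V] [Nontrivial V]
    (he : ∀ v : V, v ^ p = 1) (a b : ZMod p) (h : ∀ v : V, v ^ a.val = v ^ b.val) : a = b := by
  obtain ⟨v, hv⟩ := exists_ne (1 : V)
  have ho : orderOf v = p := orderOf_eq_prime (he v) hv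
  have := pow_eq_pow_iff_modEq.mp (h v)
  rw [ho] at this
  simpa using (ZMod.natCast_eq_natCast_iff _ _ _).mpr this

/-- The homomorphism `μ : Int(V) → 𝔽_pˣ` with `α(v) = μ(α) v` for an elementary abelian `p`-group
`V`, trivial if `V` is trivial. -/
noncomputable def intenseScalarHom (p : ℕ) [Fact p.Prime] {V : Type*} [Group V]
    (hc : ∀ v w : V, v * w = w * v) (he : ∀ v : V, v ^ p = 1) : intenseAut V →* (ZMod p)ˣ :=
  MonoidHom.mk' (intenseScalar p hc he) fun α β => by
    by_cases hV : Nontrivial V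
    · apply Units.ext
      apply intenseScalar_unique p he
      intro v
      have hpow : ∀ a b : ZMod p, v ^ (a * b).val = (v ^ b.val) ^ a.val := by
        intro a b
        rw [← pow_mul, ZMod.val_mul, mul_comm b.val]
        exact (pow_eq_pow_mod _ (he v)).symm
      rw [← intenseScalar_spec, Units.val_mul, hpow, ← intenseScalar_spec, ← intenseScalar_spec]
      rfl
    · simp [intenseScalar, hV]

/-- The Teichmüller character `ω : 𝔽_pˣ → ℤ_pˣ`. -/
noncomputable def teichmullerChar (p : ℕ) [Fact p.Prime] : (ZMod p)ˣ →* ℤ_[p]ˣ :=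
  Units.map ((WittVector.equiv p).toMonoidHom.comp (WittVector.teichmuller p))

/-- The Teichmüller character is a section of the reduction map `ℤ_pˣ → 𝔽_pˣ`. -/
theorem toZMod_teichmullerChar (p : ℕ) [Fact p.Prime] (a : (ZMod p)ˣ) :
    PadicInt.toZMod (teichmullerChar p a : ℤ_[p]) = (a : ZMod p) := by
  have hu : ∀ (g : ℤ_[p] →+* ZMod p) (x : ℤ_[p]), g x = PadicInt.toZMod x := by
    intro g x
    have hx := PadicInt.sub_zmodRepr_mem x
    rw [PadicInt.maximalIdeal_eq_span_p, Ideal.mem_span_singleton] at hx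
    obtain ⟨y, hy⟩ := hx
    rw [sub_eq_iff_eq_add.mp hy]
    simp
  have h := hu (WittVector.constantCoeff.comp (WittVector.equiv p).symm.toRingHom)
    (teichmullerChar p a : ℤ_[p])
  rw [← h]
  simp [teichmullerChar, WittVector.constantCoeff]

/-- The subgroup `Gᵖ[G,G]`, which is the Frattini subgroup of `G` if `G` is a finite `p`-group. -/
def pFrattini (p : ℕ) (G : Type*) [Group G] : Subgroup G :=
  Subgroup.closure (Set.range fun x : G => x ^ p) ⊔ commutator G

instance pFrattini_normal (p : ℕ) (G : Type*) [Group G] : (pFrattini p G).Normal where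
  conj_mem n hn g := by
    have h : g * n * g⁻¹ * n⁻¹ ∈ commutator G :=
      Subgroup.commutator_mem_commutator (Subgroup.mem_top g) (Subgroup.mem_top n)
    have h2 := (pFrattini p G).mul_mem (le_sup_right (a := Subgroup.closure _) h) hn
    simpa using h2

theorem quotient_pFrattini_comm (p : ℕ) (G : Type*) [Group G] (v w : G ⧸ pFrattini p G) :
    v * w = w * v := by
  obtain ⟨x, rfl⟩ := QuotientGroup.mk_surjective v
  obtain ⟨y, rfl⟩ := QuotientGroup.mk_surjective w
  rw [← QuotientGroup.mk_mul, ← QuotientGroup.mk_mul, QuotientGroup.eq]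
  have h : y⁻¹ * x⁻¹ * y⁻¹⁻¹ * x⁻¹⁻¹ ∈ commutator G :=
    Subgroup.commutator_mem_commutator (Subgroup.mem_top _) (Subgroup.mem_top _)
  have h2 : y⁻¹ * x⁻¹ * y⁻¹⁻¹ * x⁻¹⁻¹ ∈ pFrattini p G := le_sup_right (a := Subgroup.closure _) h
  simpa [mul_assoc] using h2

theorem quotient_pFrattini_pow (p : ℕ) (G : Type*) [Group G] (v : G ⧸ pFrattini p G) :
    v ^ p = 1 := by
  obtain ⟨x, rfl⟩ := QuotientGroup.mk_surjective v
  rw [← QuotientGroup.mk_pow, QuotientGroup.eq_one_iff]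
  exact le_sup_left (b := commutator G) (Subgroup.subset_closure ⟨x, rfl⟩)

/-- The intense character `χ_G : Int(G) → ℤ_pˣ` of a finite `p`-group `G`: the composition of
`Int(G) → Int(G ⧸ Φ(G))` with the homomorphism `ω ∘ μ : Int(G ⧸ Φ(G)) → ℤ_pˣ`. -/
noncomputable def intenseCharacter (p : ℕ) [Fact p.Prime] (G : Type*) [Group G] :
    intenseAut G →* ℤ_[p]ˣ :=
  ((teichmullerChar p).comp (intenseScalarHom p (quotient_pFrattini_comm p G)
    (quotient_pFrattini_pow p G))).comp (intenseAutQuotient (pFrattini p G))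

/-- The intensity of a finite `p`-group `G`: the index `|Int(G) : ker χ_G|`. -/
noncomputable def intensity (p : ℕ) [Fact p.Prime] (G : Type*) [Group G] : ℕ :=
  (intenseCharacter p G).ker.index

open scoped commutatorElement

/-! Write A = [G,G] and B = [A,G]; class three means that B is central and non-trivial. The
Teichmüller character is injective, so the intensity counts the scalars λ by which intense
automorphisms act on G/Φ(G). Once G/A has exponent p, such an automorphism acts by λ on G/A and by
λ² on A/B, and in the index p² case by λ³ on B. Intensity on suitable subgroups makes a second
scalar act on the same element, and an element on which two distinct scalars act is trivial.

Suppose λ ≠ 1. Playing λ against λ² shows that G/A has exponent p (`IsIntense.pow_mem_commutator`)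
and that p-th powers lie in B (`IsIntense.pow_mem_gammaThree`). For the index, compare the
conjugating elements attached to ⟨z,x⟩B and ⟨z,xw⟩B with w ∈ A. Their quotient h satisfies [h,z] ≡ 1
and [h,x] ≡ w^(1-λ) modulo ⟨[z,x]⟩B (`IsIntense.exists_commutatorElement_mem`). If z ∉ A does not
centralise A, this forces A = ⟨[z,x]⟩B and then G = ⟨z,x⟩A.

Conversely let p be odd and |G:A| = p². Then A/B has order p, A is abelian of exponent p, and p-th
powers lie in B. If λ² ≠ 1, then B would be generated by [y,c] for all y ∉ A and c ∈ A \ B, although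
some such y centralises c (`dvd_mul_self_sub_one`). So λ = ±1. The value -1 occurs: the pairs
(x,x⁻¹), (y,y⁻¹) generate the graph of an automorphism α of order two (`exists_involution`). It
inverts G/A and B and fixes some c ∈ A \ B, and with this each subgroup is moved to an α-stable
conjugate (`exists_stable_conj`), so α is intense. -/

theorem IsPGroup.mem_of_zpow_mem {p : ℕ} [Fact p.Prime] {G : Type*} [Group G]
    (hG : IsPGroup p G) {S : Subgroup G} {x : G} {i : ℤ} (hi : ¬ (p : ℤ) ∣ i) (h : x ^ i ∈ S) :
    x ∈ S := by
  obtain ⟨n, hn⟩ := hG x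
  have hco : IsCoprime i ((p : ℤ) ^ n) := by
    apply IsCoprime.pow_right
    rw [isCoprime_comm]
    exact (Nat.prime_iff_prime_int.mp Fact.out).coprime_iff_not_dvd.mpr hi
  obtain ⟨a, b, hab⟩ := hco
  have : x = (x ^ i) ^ a := by
    conv_lhs => rw [← zpow_one x, ← hab, zpow_add, mul_comm b, zpow_mul x _ b]
    have : x ^ ((p : ℤ) ^ n) = 1 := by exact_mod_cast hn
    rw [this, one_zpow, mul_one, mul_comm, zpow_mul]
  rw [this]
  exact S.zpow_mem h a

/-- The complement of a proper subgroup S generates: if u ∉ S and g ∈ S, then gu ∉ S. -/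
theorem Subgroup.eq_top_of_forall_notMem {G : Type*} [Group G] {S T : Subgroup G} (hS : S ≠ ⊤)
    (h : ∀ g, g ∉ S → g ∈ T) : T = ⊤ := by
  obtain ⟨u, hu⟩ : ∃ u, u ∉ S := by
    by_contra! hc
    exact hS (Subgroup.eq_top_iff' S |>.mpr hc)
  refine (Subgroup.eq_top_iff' T).mpr fun g => ?_
  by_cases hg : g ∈ S
  · have h1 : g * u ∉ S := fun h2 => hu ((S.mul_mem_cancel_left hg).mp h2)
    exact (T.mul_mem_cancel_right (h u hu)).mp (h _ h1)
  · exact h g hg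

/-! ### Commutator calculus with central values -/

section Commutators

variable {G : Type*} [Group G]

theorem commutatorElement_mul_left_of_central {a b c : G} (h : ⁅b, c⁆ ∈ Subgroup.center G) :
    ⁅a * b, c⁆ = ⁅a, c⁆ * ⁅b, c⁆ := by
  have h1 := Subgroup.mem_center_iff.mp h a
  have h2 := Subgroup.mem_center_iff.mp h ⁅a, c⁆
  rw [commutatorElement_mul_left_eq_conj_mul, h1, h2]
  group

/-- The homomorphism `b ↦ ⁅b, c⁆`, if all its values are central. -/
def commutatorLeftHom (c : G) (h : ∀ b : G, ⁅b, c⁆ ∈ Subgroup.center G) : G →* G :=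
  MonoidHom.mk' (fun b => ⁅b, c⁆) fun _ b => commutatorElement_mul_left_of_central (h b)

theorem commutatorElement_zpow_left_of_central {c : G} (h : ∀ b : G, ⁅b, c⁆ ∈ Subgroup.center G)
    (b : G) (n : ℤ) : ⁅b ^ n, c⁆ = ⁅b, c⁆ ^ n :=
  map_zpow (commutatorLeftHom c h) b n

theorem commutatorElement_pow_left_of_central {c : G} (h : ∀ b : G, ⁅b, c⁆ ∈ Subgroup.center G)
    (b : G) (n : ℕ) : ⁅b ^ n, c⁆ = ⁅b, c⁆ ^ n :=
  map_pow (commutatorLeftHom c h) b n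

theorem commutatorElement_mul_right_of_central {a b c : G} (h : ⁅a, c⁆ ∈ Subgroup.center G) :
    ⁅a, b * c⁆ = ⁅a, b⁆ * ⁅a, c⁆ := by
  have := Subgroup.mem_center_iff.mp h b
  rw [commutatorElement_mul_right_eq_mul_conj, mul_assoc, mul_assoc, ← mul_assoc b, this]
  group

/-- The homomorphism `b ↦ ⁅a, b⁆`, if all its values are central. -/
def commutatorRightHom (a : G) (h : ∀ b : G, ⁅a, b⁆ ∈ Subgroup.center G) : G →* G :=
  MonoidHom.mk' (fun b => ⁅a, b⁆) fun _ b => commutatorElement_mul_right_of_central (h b)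

theorem commutatorElement_zpow_right_of_central {a : G} (h : ∀ b : G, ⁅a, b⁆ ∈ Subgroup.center G)
    (b : G) (n : ℤ) : ⁅a, b ^ n⁆ = ⁅a, b⁆ ^ n :=
  map_zpow (commutatorRightHom a h) b n

theorem commutatorElement_pow_right_of_central {a : G} (h : ∀ b : G, ⁅a, b⁆ ∈ Subgroup.center G)
    (b : G) (n : ℕ) : ⁅a, b ^ n⁆ = ⁅a, b⁆ ^ n :=
  map_pow (commutatorRightHom a h) b n

theorem commutatorElement_mem_commutator (a b : G) : ⁅a, b⁆ ∈ commutator G :=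
  Subgroup.commutator_mem_commutator (Subgroup.mem_top _) (Subgroup.mem_top _)

theorem commutatorElement_of_mem_center_left {a : G} (h : a ∈ Subgroup.center G) (b : G) :
    ⁅a, b⁆ = 1 :=
  commutatorElement_eq_one_iff_mul_comm.mpr (Subgroup.mem_center_iff.mp h b).symm

theorem commutatorElement_of_mem_center_right {a : G} (h : a ∈ Subgroup.center G) (b : G) :
    ⁅b, a⁆ = 1 :=
  commutatorElement_eq_one_iff_mul_comm.mpr (Subgroup.mem_center_iff.mp h b)

theorem commutatorElement_mul_center_left {z : G} (hz : z ∈ Subgroup.center G) (a b : G) :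
    ⁅a * z, b⁆ = ⁅a, b⁆ := by
  have h := commutatorElement_of_mem_center_left hz b
  rw [commutatorElement_mul_left_of_central (by rw [h]; exact one_mem _), h, mul_one]

theorem commutatorElement_mul_center_right {z : G} (hz : z ∈ Subgroup.center G) (a b : G) :
    ⁅a, b * z⁆ = ⁅a, b⁆ := by
  have h := commutatorElement_of_mem_center_right hz a
  rw [commutatorElement_mul_right_of_central (by rw [h]; exact one_mem _), h, mul_one]

/-- Normal form in a group generated by `x` and `y` with `⁅x, y⁆` central. -/
theorem exists_zpow_of_mem_closure_pair {x y : G} (hx : Commute x ⁅x, y⁆) (hy : Commute y ⁅x, y⁆)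
    {g : G} (hg : g ∈ Subgroup.closure {x, y}) :
    ∃ i j k : ℤ, g = x ^ i * y ^ j * ⁅x, y⁆ ^ k := by
  set c := ⁅x, y⁆ with hc
  have e1 : y * x * y⁻¹ = c⁻¹ * x := by rw [hc, commutatorElement_def]; group
  have e2 : y⁻¹ * x * y = c * x := by
    have : Commute y⁻¹ c := hy.inv_left
    calc y⁻¹ * x * y = (y⁻¹ * c) * (y * x * y⁻¹) * y := by rw [e1]; group
      _ = c * x := by rw [this.eq]; group
  induction hg using Subgroup.closure_induction_left with
  | one => exact ⟨0, 0, 0, by simp⟩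
  | mul_left u hu v hv ih =>
    obtain ⟨i, j, k, rfl⟩ := ih
    rcases hu with rfl | rfl
    · exact ⟨i + 1, j, k, by rw [zpow_add, zpow_one, ← (Commute.refl u).zpow_right i |>.eq]; group⟩
    · refine ⟨i, j + 1, k - i, ?_⟩
      have h1 : u * x ^ i * u⁻¹ = c⁻¹ ^ i * x ^ i := by
        rw [← conj_zpow, e1, hx.symm.inv_left.mul_zpow]
      have h2 : Commute (c ^ (-i)) (x ^ i * u ^ (j + 1)) :=
        ((hx.symm.zpow_zpow _ _).mul_right (hy.symm.zpow_zpow _ _))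
      calc u * (x ^ i * u ^ j * c ^ k) = (u * x ^ i * u⁻¹) * u ^ (j + 1) * c ^ k := by
            rw [zpow_add, zpow_one]; group
        _ = (c ^ (-i) * (x ^ i * u ^ (j + 1))) * c ^ k := by rw [h1]; group
        _ = _ := by rw [h2.eq, zpow_sub]; group
  | inv_mul_cancel u hu v hv ih =>
    obtain ⟨i, j, k, rfl⟩ := ih
    rcases hu with rfl | rfl
    · exact ⟨i - 1, j, k, by group⟩
    · refine ⟨i, j - 1, k + i, ?_⟩
      have h1 : u⁻¹ * x ^ i * u = c ^ i * x ^ i := by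
        have := conj_zpow (i := i) (a := u⁻¹) (b := x)
        rw [inv_inv, e2] at this
        rw [← this, hx.symm.mul_zpow]
      have h2 : Commute (c ^ i) (x ^ i * u ^ (j - 1)) :=
        ((hx.symm.zpow_zpow _ _).mul_right (hy.symm.zpow_zpow _ _))
      calc u⁻¹ * (x ^ i * u ^ j * c ^ k) = (u⁻¹ * x ^ i * u) * u ^ (j - 1) * c ^ k := by
            rw [zpow_sub, zpow_one]; group
        _ = (c ^ i * (x ^ i * u ^ (j - 1))) * c ^ k := by rw [h1]; group
        _ = _ := by rw [h2.eq, zpow_add]; group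

/-- Normal form in the subgroup generated by `x`, `y` and a central subgroup `K`, with `⁅x, y⁆`
central modulo `K`. -/
theorem exists_zpow_of_mem_closure_pair_sup {K : Subgroup G} [K.Normal] {x y : G}
    (hx : ⁅x, ⁅x, y⁆⁆ ∈ K) (hy : ⁅y, ⁅x, y⁆⁆ ∈ K)
    {g : G} (hg : g ∈ Subgroup.closure {x, y} ⊔ K) :
    ∃ i j k : ℤ, ∃ t ∈ K, g = x ^ i * y ^ j * ⁅x, y⁆ ^ k * t := by
  obtain ⟨u, hu, t, ht, rfl⟩ := Subgroup.mem_sup_of_normal_right.mp hg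
  let q := QuotientGroup.mk' K
  have hq : ∀ a, a ∈ K ↔ q a = 1 := fun a => (QuotientGroup.eq_one_iff a).symm
  have hu' : q u ∈ Subgroup.closure {q x, q y} := by
    have := Subgroup.mem_map_of_mem q hu
    rwa [MonoidHom.map_closure, Set.image_pair] at this
  rw [hq, map_commutatorElement, map_commutatorElement,
    commutatorElement_eq_one_iff_commute] at hx hy
  obtain ⟨i, j, k, h⟩ := exists_zpow_of_mem_closure_pair hx hy hu'
  refine ⟨i, j, k, (x ^ i * y ^ j * ⁅x, y⁆ ^ k)⁻¹ * u * t, ?_, by group⟩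
  refine K.mul_mem ?_ ht
  rw [hq]
  simp only [map_mul, map_inv, map_zpow, map_commutatorElement]
  rw [h]
  group

/-- The power formula in class two. -/
theorem mul_pow_of_central {a b : G} (h : ⁅b, a⁆ ∈ Subgroup.center G) (n : ℕ) :
    (a * b) ^ n = a ^ n * b ^ n * ⁅b, a⁆ ^ (n.choose 2) := by
  have hz : ∀ (k : ℕ) (g : G), g * ⁅b, a⁆ ^ k = ⁅b, a⁆ ^ k * g := fun k =>
    Subgroup.mem_center_iff.mp (Subgroup.pow_mem _ h k)
  induction n with
  | zero => simp
  | succ n ih =>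
    have e : b ^ n * a = ⁅b, a⁆ ^ n * a * b ^ n := by
      have h1 : a⁻¹ * b * a = ⁅b, a⁆ * b := by
        have := Subgroup.mem_center_iff.mp h a
        calc a⁻¹ * b * a = a⁻¹ * (⁅b, a⁆ * a) * b := by rw [commutatorElement_def]; group
          _ = _ := by rw [← this]; group
      have h2 : Commute ⁅b, a⁆ b := (Subgroup.mem_center_iff.mp h b).symm
      have h3 : a⁻¹ * b ^ n * a = ⁅b, a⁆ ^ n * b ^ n := by
        rw [← h2.mul_pow, ← h1]
        simpa using (conj_pow (i := n) (a := a⁻¹) (b := b)).symm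
      calc b ^ n * a = a * (a⁻¹ * b ^ n * a) := by group
        _ = _ := by rw [h3, ← mul_assoc, hz]
    calc (a * b) ^ (n + 1) = a ^ n * b ^ n * (⁅b, a⁆ ^ n.choose 2 * (a * b)) := by
          rw [pow_succ, ih, mul_assoc]
      _ = a ^ n * (b ^ n * a) * b * ⁅b, a⁆ ^ n.choose 2 := by rw [← hz]; simp only [mul_assoc]
      _ = a ^ n * ⁅b, a⁆ ^ n * (a * b ^ n * b) * ⁅b, a⁆ ^ n.choose 2 := by
          rw [e]; simp only [mul_assoc]
      _ = ⁅b, a⁆ ^ n * (a ^ (n + 1) * b ^ (n + 1)) * ⁅b, a⁆ ^ n.choose 2 := by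
          rw [hz n, pow_succ a, pow_succ b]; simp only [mul_assoc]
      _ = _ := by
          rw [← hz, Nat.choose_succ_succ' n 1, Nat.choose_one_right, pow_add ⁅b, a⁆, mul_assoc]

/-- The formula for `⁅xⁿ, y⁆` when `⁅x, ⁅x, y⁆⁆` is central. -/
theorem commutatorElement_pow_left {x y : G} (h : ⁅x, ⁅x, y⁆⁆ ∈ Subgroup.center G) (n : ℕ) :
    ⁅x ^ n, y⁆ = ⁅x, y⁆ ^ n * ⁅x, ⁅x, y⁆⁆ ^ (n.choose 2) := by
  set c := ⁅x, y⁆ with hc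
  set d := ⁅x, c⁆ with hd
  have hz : ∀ (k : ℕ) (g : G), g * d ^ k = d ^ k * g := fun k =>
    Subgroup.mem_center_iff.mp (Subgroup.pow_mem _ h k)
  have hdc : Commute d c := (Subgroup.mem_center_iff.mp h c).symm
  induction n with
  | zero => simp
  | succ n ih =>
    have e : x * c ^ n * x⁻¹ = d ^ n * c ^ n := by
      rw [← conj_pow, ← hdc.mul_pow, hd, commutatorElement_def]; group
    calc ⁅x ^ (n + 1), y⁆ = x * ⁅x ^ n, y⁆ * x⁻¹ * c := by
          rw [hc, commutatorElement_def, commutatorElement_def, commutatorElement_def, pow_succ']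
          group
      _ = x * c ^ n * (d ^ n.choose 2 * x⁻¹) * c := by rw [ih]; simp only [mul_assoc]
      _ = x * c ^ n * x⁻¹ * (d ^ n.choose 2 * c) := by rw [← hz]; simp only [mul_assoc]
      _ = d ^ n * (c ^ n * c) * d ^ n.choose 2 := by rw [e, ← hz _ c]; simp only [mul_assoc]
      _ = _ := by
          rw [← hz, ← pow_succ, Nat.choose_succ_succ' n 1, Nat.choose_one_right, pow_add d,
            mul_assoc]

end Commutators

theorem IsIntense.apply_mem {G : Type*} [Group G] {α : MulAut G} (hα : IsIntense α)
    {N : Subgroup G} [N.Normal] {x : G} (hx : x ∈ N) : α x ∈ N := by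
  have h := intenseAut_map_normal N (⟨α, hα⟩ : intenseAut G)
  rw [← h]
  exact Subgroup.mem_map_of_mem _ hx

theorem IsIntense.exists_conj_mem {G : Type*} [Group G] {α : MulAut G} (hα : IsIntense α)
    (H : Subgroup G) : ∃ g : G, ∀ h ∈ H, g⁻¹ * α h * g ∈ H := by
  obtain ⟨g, hg⟩ := hα H
  refine ⟨g, fun h hh => ?_⟩
  have h1 : α h ∈ H.map (MulAut.conj g).toMonoidHom := by
    rw [← hg]; exact Subgroup.mem_map_of_mem _ hh
  obtain ⟨k, hk, e⟩ := h1
  have e' : g * k * g⁻¹ = α h := e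
  rw [← e']
  simpa [mul_assoc] using hk

theorem Subgroup.normal_of_le_center {G : Type*} [Group G] {N : Subgroup G}
    (h : N ≤ Subgroup.center G) : N.Normal :=
  ⟨fun n hn g => by rw [Subgroup.mem_center_iff.mp (h hn) g]; simpa using hn⟩

theorem zpowers_normal_of_mem_center {G : Type*} [Group G] {z : G}
    (h : z ∈ Subgroup.center G) : (Subgroup.zpowers z).Normal :=
  Subgroup.normal_of_le_center (by simpa [Subgroup.zpowers_le] using h)

theorem exists_commutatorElement_notMem {G : Type*} [Group G] {H N : Subgroup G}
    (h : ¬ ⁅H, (⊤ : Subgroup G)⁆ ≤ N) : ∃ a ∈ H, ∃ b : G, ⁅a, b⁆ ∉ N := by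
  by_contra! hc
  exact h (Subgroup.commutator_le.mpr fun a ha b _ => hc a ha b)

/-- The elements of `G` whose `n`-th power lies in `[G, G]`. -/
def powMemCommutator (n : ℕ) (G : Type*) [Group G] : Subgroup G :=
  ((powMonoidHom n).comp (Abelianization.of (G := G))).ker

theorem mem_powMemCommutator {n : ℕ} {G : Type*} [Group G] {x : G} :
    x ∈ powMemCommutator n G ↔ x ^ n ∈ commutator G := by
  rw [powMemCommutator, MonoidHom.mem_ker, ← Abelianization.ker_of, MonoidHom.mem_ker]
  simp

theorem pow_mem_pFrattini (p : ℕ) {G : Type*} [Group G] (x : G) : x ^ p ∈ pFrattini p G :=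
  le_sup_left (b := commutator G) (Subgroup.subset_closure ⟨x, rfl⟩)

theorem commutator_le_pFrattini (p : ℕ) (G : Type*) [Group G] : commutator G ≤ pFrattini p G :=
  le_sup_right

theorem map_commutator_mk' {G : Type*} [Group G] (N : Subgroup G) [N.Normal] :
    (commutator G).map (QuotientGroup.mk' N) = commutator (G ⧸ N) := by
  rw [commutator_def, commutator_def, Subgroup.map_commutator,
    Subgroup.map_top_of_surjective _ (QuotientGroup.mk'_surjective N)]

theorem map_pFrattini_mk'_le (p : ℕ) {G : Type*} [Group G] (N : Subgroup G) [N.Normal] :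
    (pFrattini p G).map (QuotientGroup.mk' N) ≤ pFrattini p (G ⧸ N) := by
  rw [pFrattini, Subgroup.map_sup, MonoidHom.map_closure, map_commutator_mk']
  refine sup_le_sup_right (Subgroup.closure_mono ?_) _
  rintro _ ⟨_, ⟨x, rfl⟩, rfl⟩
  exact ⟨QuotientGroup.mk' N x, by simp⟩

/-! ### Exponent of the abelianization -/

section

variable {p : ℕ} [Fact p.Prime]

theorem prime_int_of_fact : Prime (p : ℤ) := Nat.prime_iff_prime_int.mp Fact.out

/-- If `⁅G, G⁆` is central of exponent `p` and non-trivial, and `G` has an intense automorphism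
with non-trivial character, then `G / ⁅G, G⁆` has exponent `p`. -/
theorem pow_mem_commutator_of_central {G : Type*} [Group G] (hG : IsPGroup p G)
    (hZ : commutator G ≤ Subgroup.center G) (hexp : ∀ w ∈ commutator G, w ^ p = 1)
    (hne : commutator G ≠ ⊥) {α : MulAut G} (hα : IsIntense α) {l : ℕ}
    (hl : ∀ x, α x * (x ^ l)⁻¹ ∈ pFrattini p G) (hl0 : ¬ (p : ℤ) ∣ l) (hl1 : ¬ (p : ℤ) ∣ l - 1)
    (x : G) : x ^ p ∈ commutator G := by
  have hc : ∀ a b : G, ⁅a, b⁆ ∈ Subgroup.center G := fun a b =>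
    hZ (commutatorElement_mem_commutator a b)
  have hΦ : pFrattini p G ≤ Subgroup.center G := by
    refine sup_le ((Subgroup.closure_le _).mpr ?_) hZ
    rintro _ ⟨x, rfl⟩
    refine Subgroup.mem_center_iff.mpr fun g => ?_
    have : ⁅x ^ p, g⁆ = 1 := by
      rw [commutatorElement_pow_left_of_central (fun b => hc b g)]
      exact hexp _ (commutatorElement_mem_commutator _ _)
    exact (commutatorElement_eq_one_iff_mul_comm.mp this).symm
  obtain ⟨a, -, b, hab⟩ : ∃ a ∈ (⊤ : Subgroup G), ∃ b : G, ⁅a, b⁆ ∉ (⊥ : Subgroup G) :=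
    exists_commutatorElement_notMem (fun h => hne (le_bot_iff.mp h))
  rw [Subgroup.mem_bot] at hab
  have hΦt : pFrattini p G ≠ ⊤ := fun h => hab
    (commutatorElement_of_mem_center_left (hΦ (h ▸ Subgroup.mem_top a)) b)
  set w := ⁅a, b⁆ with hw
  have hwA : w ∈ commutator G := commutatorElement_mem_commutator a b
  have hαeq : ∀ x, ∃ f ∈ pFrattini p G, α x = x ^ l * f := fun x =>
    ⟨_, hl x, by rw [Subgroup.mem_center_iff.mp (hΦ (hl x))]; group⟩
  have hαw : α w = w ^ ((l : ℤ) * l) := by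
    obtain ⟨f, hf, ef⟩ := hαeq a
    obtain ⟨f', hf', ef'⟩ := hαeq b
    rw [hw, map_commutatorElement, ef, ef', commutatorElement_mul_center_left (hΦ hf),
      commutatorElement_mul_center_right (hΦ hf'),
      commutatorElement_pow_left_of_central (fun b' => hc b' _),
      commutatorElement_pow_right_of_central (fun b' => hc _ b'), ← pow_mul]
    exact_mod_cast rfl
  by_contra hx
  -- Elements with p-th power in A form a subgroup, so a counterexample exists outside Φ(G), where
  -- exponents are determined modulo p.
  obtain ⟨y, hyΦ, hyA⟩ : ∃ y, y ∉ pFrattini p G ∧ y ^ p ∉ commutator G := by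
    by_contra! h
    have : powMemCommutator p G = ⊤ :=
      Subgroup.eq_top_of_forall_notMem hΦt fun g hg => mem_powMemCommutator.mpr (h g hg)
    exact hx (mem_powMemCommutator.mp (this ▸ Subgroup.mem_top x))
  have hn : (Subgroup.zpowers y ⊔ commutator G).Normal :=
    Subgroup.Normal.of_commutator_le _ le_sup_right
  obtain ⟨u, hu, c, hcA, e⟩ := Subgroup.mem_sup_of_normal_right.mp
    (hα.apply_mem (N := Subgroup.zpowers y ⊔ commutator G)
      (Subgroup.mem_sup_left (Subgroup.mem_zpowers y)))
  obtain ⟨m, rfl⟩ := Subgroup.mem_zpowers_iff.mp hu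
  have hml : (p : ℤ) ∣ m - l := by
    by_contra hd
    refine hyΦ (hG.mem_of_zpow_mem hd ?_)
    obtain ⟨f, hf, ef⟩ := hαeq y
    have : y ^ (m - l) = f * c⁻¹ := by
      rw [← e] at ef
      have e3 : y ^ m = y ^ l * (f * c⁻¹) := by rw [← mul_assoc, ← ef]; group
      rw [sub_eq_neg_add, zpow_add, e3]; simp
    rw [this]
    exact mul_mem hf (inv_mem (commutator_le_pFrattini p G hcA))
  set z := y ^ p with hz
  have hzZ : z ∈ Subgroup.center G := hΦ (pow_mem_pFrattini p y)
  have hαz : α z = z ^ m := by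
    have hcomm : Commute (y ^ m) c := Subgroup.mem_center_iff.mp (hZ hcA) _
    rw [hz, map_pow, ← e, hcomm.mul_pow, hexp c hcA, mul_one, ← zpow_natCast, ← zpow_natCast,
      ← zpow_mul, ← zpow_mul, mul_comm]
  -- The product zw ties the exponent m ≡ λ on z to λ² on w: α raises zw to a single power k.
  have := zpowers_normal_of_mem_center (mul_mem hzZ (hZ hwA))
  obtain ⟨k, hk⟩ := Subgroup.mem_zpowers_iff.mp
    (hα.apply_mem (N := Subgroup.zpowers (z * w)) (Subgroup.mem_zpowers _))
  have hzw : Commute z w := Subgroup.mem_center_iff.mp (hZ hwA) z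
  rw [map_mul, hαz, hαw, hzw.mul_zpow] at hk
  have hkey : z ^ (k - m) = w ^ ((l : ℤ) * l - k) := by
    rw [sub_eq_neg_add, zpow_add, sub_eq_add_neg, zpow_add, zpow_neg, zpow_neg,
      inv_mul_eq_iff_eq_mul, ← mul_assoc, ← hk]
    group
  have hkm : (p : ℤ) ∣ k - m := by
    by_contra hd
    exact hyA (hG.mem_of_zpow_mem hd (hkey ▸ zpow_mem hwA _))
  have hp := prime_int_of_fact (p := p)
  have hll : ¬ (p : ℤ) ∣ (l : ℤ) * l - l := by
    intro h
    rw [show (l : ℤ) * l - l = l * (l - 1) by ring] at h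
    exact (hp.dvd_or_dvd h).elim hl0 hl1
  have hwz : w ∈ Subgroup.zpowers z := by
    refine hG.mem_of_zpow_mem (i := (l : ℤ) * l - k) (fun h => hll ?_)
      (hkey ▸ zpow_mem (Subgroup.mem_zpowers z) _)
    have := dvd_add (dvd_add h hkm) hml
    ring_nf at this ⊢
    exact this
  obtain ⟨n, hn⟩ := Subgroup.mem_zpowers_iff.mp hwz
  have h3 : w ^ ((l : ℤ) * l - m) = 1 := by
    rw [zpow_sub, ← hαw, ← hn, map_zpow, hαz, ← zpow_mul, ← zpow_mul, mul_comm, mul_inv_cancel]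
  refine hab (Subgroup.mem_bot.mp (hG.mem_of_zpow_mem (i := (l : ℤ) * l - m) (fun h => hll ?_)
    (Subgroup.mem_bot.mpr h3)))
  have := dvd_add h hml
  ring_nf at this ⊢
  exact this

/-- Otherwise N would lie in every term of the lower central series. -/
theorem commutator_top_ne_self {G : Type*} [Group G] [Group.IsNilpotent G] {N : Subgroup G}
    (h : N ≠ ⊥) : ⁅N, (⊤ : Subgroup G)⁆ ≠ N := by
  intro he
  obtain ⟨n, hn⟩ := Subgroup.nilpotent_iff_lowerCentralSeries.mp ‹Group.IsNilpotent G›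
  have : ∀ k, N ≤ (⊤ : Subgroup G).lowerCentralSeries k := by
    intro k
    induction k with
    | zero => exact le_top
    | succ k ih =>
      rw [Subgroup.lowerCentralSeries_succ]
      conv_lhs => rw [← he]
      exact Subgroup.commutator_mono ih le_rfl
  exact h (le_bot_iff.mp (hn ▸ this n))

/-- If a non-abelian finite `p`-group `G` has an intense automorphism with non-trivial character,
then `G / ⁅G, G⁆` has exponent `p`. -/
theorem IsIntense.pow_mem_commutator {G : Type*} [Group G] [Finite G] (hG : IsPGroup p G)
    (hne : commutator G ≠ ⊥) {α : MulAut G} (hα : IsIntense α) {l : ℕ}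
    (hl : ∀ x, α x * (x ^ l)⁻¹ ∈ pFrattini p G) (hl0 : ¬ (p : ℤ) ∣ l) (hl1 : ¬ (p : ℤ) ∣ l - 1)
    (x : G) : x ^ p ∈ commutator G := by
  induction hn : Nat.card G using Nat.strong_induction_on generalizing G with
  | _ n ih =>
  -- If N is non-trivial, normal and properly inside A, then G/N is still non-abelian and induction
  -- applies. If there is no such N, then A is minimal normal, hence central of exponent p.
  by_cases hmin : ∃ N : Subgroup G, N.Normal ∧ N ≠ ⊥ ∧ N ≤ commutator G ∧ N ≠ commutator G
  · obtain ⟨N, hN, hN0, hNA, hNne⟩ := hmin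
    have hcard : Nat.card (G ⧸ N) < n := by
      rw [← hn, N.card_eq_card_quotient_mul_card_subgroup]
      exact lt_mul_of_one_lt_right Nat.card_pos
        ((Subgroup.one_lt_card_iff_ne_bot N).mpr hN0)
    have hne' : commutator (G ⧸ N) ≠ ⊥ := by
      rw [← map_commutator_mk', Ne, Subgroup.map_eq_bot_iff, QuotientGroup.ker_mk']
      exact fun h => hNne (le_antisymm hNA h)
    have := ih _ hcard (hG.to_quotient N) hne' (isIntense_intenseQuotientAut N ⟨α, hα⟩)
      (fun v => by
        obtain ⟨v, rfl⟩ := QuotientGroup.mk_surjective v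
        exact map_pFrattini_mk'_le p N (Subgroup.mem_map_of_mem _ (hl v))) (x : G ⧸ N) rfl
    rw [← map_commutator_mk'] at this
    obtain ⟨c, hc, e⟩ := this
    have : c⁻¹ * x ^ p ∈ N := QuotientGroup.eq.mp e
    exact ((commutator G).mul_mem_cancel_left (inv_mem hc)).mp (hNA this)
  · push Not at hmin
    have : Group.IsNilpotent G := hG.isNilpotent
    have hZ : commutator G ≤ Subgroup.center G := by
      rw [← Subgroup.commutator_top_right_eq_bot_iff_le_center]
      by_contra h
      exact commutator_top_ne_self hne (hmin _ inferInstance h (Subgroup.commutator_le_left _ _))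
    refine pow_mem_commutator_of_central hG hZ (fun w hw => ?_) hne hα hl hl0 hl1 x
    by_contra h
    have hle : Subgroup.zpowers (w ^ p) ≤ commutator G :=
      Subgroup.zpowers_le.mpr (pow_mem hw p)
    have := hmin _ (zpowers_normal_of_mem_center (pow_mem (hZ hw) p))
      (by rwa [Ne, Subgroup.zpowers_eq_bot]) hle
    rw [← this] at hw
    obtain ⟨k, hk⟩ := Subgroup.mem_zpowers_iff.mp hw
    have h1 : w ^ (p * k - 1) = 1 := by
      rw [zpow_sub, zpow_mul, zpow_natCast, hk, zpow_one, mul_inv_cancel]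
    have : w ∈ (⊥ : Subgroup G) := hG.mem_of_zpow_mem (i := p * k - 1) (fun hd =>
      prime_int_of_fact (p := p).not_isUnit (isUnit_of_dvd_one
        ((dvd_sub_right (dvd_mul_right _ _)).mp hd))) (Subgroup.mem_bot.mpr h1)
    rw [Subgroup.mem_bot] at this
    exact h (by rw [this, one_pow])

end

/-- The third term `⁅⁅G, G⁆, G⁆` of the lower central series. -/
abbrev gammaThree (G : Type*) [Group G] : Subgroup G := ⁅commutator G, (⊤ : Subgroup G)⁆

/-! ### Working modulo the third term of the lower central series -/

section ClassThree

variable {G : Type*} [Group G]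

theorem commutatorElement_mem_gammaThree_left {w : G} (hw : w ∈ commutator G) (g : G) :
    ⁅w, g⁆ ∈ gammaThree G :=
  Subgroup.commutator_mem_commutator hw (Subgroup.mem_top g)

theorem commutatorElement_mem_gammaThree_right {w : G} (hw : w ∈ commutator G) (g : G) :
    ⁅g, w⁆ ∈ gammaThree G := by
  rw [← commutatorElement_inv]
  exact inv_mem (commutatorElement_mem_gammaThree_left hw g)

theorem gammaThree_le_commutator : gammaThree G ≤ commutator G :=
  Subgroup.commutator_le_left _ _

theorem mk'_eq_one_iff {N : Subgroup G} [N.Normal] {a : G} :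
    QuotientGroup.mk' N a = 1 ↔ a ∈ N :=
  QuotientGroup.eq_one_iff a

theorem mk'_mem_center {N : Subgroup G} [N.Normal] (hN : gammaThree G ≤ N) {w : G}
    (hw : w ∈ commutator G) : QuotientGroup.mk' N w ∈ Subgroup.center (G ⧸ N) := by
  refine Subgroup.mem_center_iff.mpr fun g => ?_
  obtain ⟨g, rfl⟩ := QuotientGroup.mk'_surjective N g
  rw [← commutatorElement_eq_one_iff_mul_comm, ← map_commutatorElement, mk'_eq_one_iff]
  exact hN (commutatorElement_mem_gammaThree_right hw g)

theorem commutatorElement_quotient_mem_center {N : Subgroup G} [N.Normal] (hN : gammaThree G ≤ N)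
    (a b : G ⧸ N) : ⁅a, b⁆ ∈ Subgroup.center (G ⧸ N) := by
  obtain ⟨a, rfl⟩ := QuotientGroup.mk'_surjective N a
  obtain ⟨b, rfl⟩ := QuotientGroup.mk'_surjective N b
  rw [← map_commutatorElement]
  exact mk'_mem_center hN (commutatorElement_mem_commutator a b)

/-- The values of q on A are central, so taking n-th powers of them is multiplicative and generators
suffice. -/
theorem map_eq_pow_of_mem_commutator {Q : Type*} [Group Q] {f q : G →* Q} {n : ℕ}
    (hc : ∀ w ∈ commutator G, q w ∈ Subgroup.center Q)
    (h : ∀ a b : G, f ⁅a, b⁆ = q ⁅a, b⁆ ^ n) {w : G} (hw : w ∈ commutator G) : f w = q w ^ n := by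
  have hle : commutator G ≤ Subgroup.closure (commutatorSet G) := (commutator_eq_closure G).le
  have hle' : ∀ {x}, x ∈ Subgroup.closure (commutatorSet G) → x ∈ commutator G :=
    fun {x} hx => (commutator_eq_closure G).ge hx
  induction hle hw using Subgroup.closure_induction with
  | mem x hx => obtain ⟨a, b, rfl⟩ := hx; exact h a b
  | one => simp
  | mul x y hx hy ihx ihy =>
    have : Commute (q x) (q y) := (Subgroup.mem_center_iff.mp (hc x (hle' hx)) _).symm
    rw [map_mul, map_mul, ihx (hle' hx), ihy (hle' hy), this.mul_pow]
  | inv x hx ihx => rw [map_inv, map_inv, ihx (hle' hx), inv_pow]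

theorem not_commutator_le_gammaThree (hB : gammaThree G ≤ Subgroup.center G)
    (hB0 : gammaThree G ≠ ⊥) : ¬ commutator G ≤ gammaThree G := fun h => hB0 <|
  Subgroup.commutator_top_right_eq_bot_iff_le_center.mpr (h.trans hB)

/-- If G were cyclic modulo A, then G/B would be abelian, since A/B is central in it. So A ≤ B would
be central, and B = 1. -/
theorem zpowers_sup_commutator_ne_top (hB : gammaThree G ≤ Subgroup.center G)
    (hB0 : gammaThree G ≠ ⊥) (z : G) : Subgroup.zpowers z ⊔ commutator G ≠ ⊤ := by
  intro ht
  refine not_commutator_le_gammaThree hB hB0 (Subgroup.commutator_le.mpr fun u _ v _ => ?_)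
  have key : ∀ u : G, ∃ i : ℤ, ∃ w ∈ commutator G, u = z ^ i * w := by
    intro u
    obtain ⟨_, ⟨i, rfl⟩, w, hw, rfl⟩ := Subgroup.mem_sup_of_normal_right.mp
      (ht ▸ Subgroup.mem_top u : u ∈ Subgroup.zpowers z ⊔ commutator G)
    exact ⟨i, w, hw, rfl⟩
  obtain ⟨i, w, hw, rfl⟩ := key u
  obtain ⟨j, w', hw', rfl⟩ := key v
  rw [← mk'_eq_one_iff, map_commutatorElement, map_mul, map_mul,
    commutatorElement_mul_center_left (mk'_mem_center le_rfl hw),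
    commutatorElement_mul_center_right (mk'_mem_center le_rfl hw'), map_zpow, map_zpow]
  exact ((Commute.refl _).zpow_zpow i j).commutator_eq

theorem gammaThree_sup_zpowers_normal {c : G} (hc : c ∈ commutator G) :
    (Subgroup.zpowers c ⊔ gammaThree G).Normal := by
  rw [← Subgroup.commutator_top_right_le_iff]
  refine le_trans (Subgroup.commutator_mono ?_ le_rfl) le_sup_right
  exact sup_le (Subgroup.zpowers_le.mpr hc) gammaThree_le_commutator

theorem commute_quotient_commutator (a b : G ⧸ commutator G) : Commute a b := by
  obtain ⟨a, rfl⟩ := QuotientGroup.mk'_surjective _ a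
  obtain ⟨b, rfl⟩ := QuotientGroup.mk'_surjective _ b
  rw [← commutatorElement_eq_one_iff_commute, ← map_commutatorElement, mk'_eq_one_iff]
  exact commutatorElement_mem_commutator a b

end ClassThree

/-! ### Powers and scalars under an intense automorphism -/

section Forward

variable {p : ℕ} {G : Type*} [Group G]

theorem pFrattini_eq_commutator (h : ∀ x : G, x ^ p ∈ commutator G) :
    pFrattini p G = commutator G := by
  refine le_antisymm (sup_le ((Subgroup.closure_le _).mpr ?_) le_rfl) le_sup_right
  rintro _ ⟨x, rfl⟩
  exact h x

/-- Modulo B one has [a,b]^p = [a^p,b], which is trivial because a^p ∈ A is central there. -/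
theorem pow_mem_gammaThree_of_mem_commutator (h : ∀ x : G, x ^ p ∈ commutator G) {w : G}
    (hw : w ∈ commutator G) : w ^ p ∈ gammaThree G := by
  rw [← mk'_eq_one_iff, map_pow]
  refine (map_eq_pow_of_mem_commutator (f := 1) (fun w hw => mk'_mem_center le_rfl hw)
    (fun a b => ?_) hw).symm
  rw [MonoidHom.one_apply, map_commutatorElement, ← commutatorElement_pow_left_of_central
    (fun b' => commutatorElement_quotient_mem_center le_rfl _ _), ← map_pow]
  exact (commutatorElement_of_mem_center_left (mk'_mem_center le_rfl (h a)) _).symm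

/-- Commutation is bilinear modulo B, so the scalar gets squared. -/
theorem mk'_apply_eq_pow_of_mem_commutator {α : MulAut G} {l : ℕ}
    (hl : ∀ x, α x * (x ^ l)⁻¹ ∈ commutator G) {w : G} (hw : w ∈ commutator G) :
    QuotientGroup.mk' (gammaThree G) (α w) = QuotientGroup.mk' (gammaThree G) w ^ (l * l) := by
  refine map_eq_pow_of_mem_commutator (f := (QuotientGroup.mk' (gammaThree G)).comp α.toMonoidHom)
    (fun w hw => mk'_mem_center le_rfl hw) (fun a b => ?_) hw
  have hq : ∀ x, ∃ c ∈ Subgroup.center (G ⧸ gammaThree G), QuotientGroup.mk' (gammaThree G) (α x)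
      = QuotientGroup.mk' (gammaThree G) x ^ l * c := by
    intro x
    have h1 := mk'_mem_center (N := gammaThree G) le_rfl (hl x)
    refine ⟨_, h1, ?_⟩
    rw [Subgroup.mem_center_iff.mp h1, ← map_pow, ← map_mul, inv_mul_cancel_right]
  obtain ⟨c, hc, e⟩ := hq a
  obtain ⟨c', hc', e'⟩ := hq b
  have hcc := commutatorElement_quotient_mem_center (G := G) (N := gammaThree G) le_rfl
  change QuotientGroup.mk' (gammaThree G) (α ⁅a, b⁆) = _
  rw [map_commutatorElement, map_commutatorElement, e, e', commutatorElement_mul_center_left hc,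
    commutatorElement_mul_center_right hc', commutatorElement_pow_left_of_central (fun b => hcc b _),
    commutatorElement_pow_right_of_central (fun b => hcc _ b), ← pow_mul, map_commutatorElement]

theorem zpow_mem_of_dvd {S : Subgroup G} {x : G} (h : x ^ p ∈ S) {i : ℤ} (hi : (p : ℤ) ∣ i) :
    x ^ i ∈ S := by
  obtain ⟨k, rfl⟩ := hi
  rw [zpow_mul, zpow_natCast]
  exact zpow_mem h k

variable [Fact p.Prime]

theorem not_dvd_mul_sub {l : ℤ} (hl0 : ¬ (p : ℤ) ∣ l) (hl1 : ¬ (p : ℤ) ∣ l - 1) :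
    ¬ (p : ℤ) ∣ l * l - l := by
  intro h
  rw [show l * l - l = l * (l - 1) by ring] at h
  exact (prime_int_of_fact.dvd_or_dvd h).elim hl0 hl1

theorem dvd_of_zpow_mem (hG : IsPGroup p G) {S : Subgroup G} {x : G} (hx : x ∉ S) {i : ℤ}
    (h : x ^ i ∈ S) : (p : ℤ) ∣ i := by
  by_contra hd
  exact hx (hG.mem_of_zpow_mem hd h)

/-- Intensity on ⟨x⟩ supplies g and m; conjugation disappears in G/A, and x ∉ A pins m down modulo
p. -/
theorem IsIntense.exists_zpow_conj (hG : IsPGroup p G) {α : MulAut G} (hα : IsIntense α) {l : ℕ}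
    (hl : ∀ x, α x * (x ^ l)⁻¹ ∈ commutator G) {x : G} (hx : x ∉ commutator G) :
    ∃ (g : G) (m : ℤ), α x = g * x ^ m * g⁻¹ ∧ (p : ℤ) ∣ m - l := by
  obtain ⟨g, hg⟩ := hα.exists_conj_mem (Subgroup.zpowers x)
  obtain ⟨m, hm⟩ := Subgroup.mem_zpowers_iff.mp (hg x (Subgroup.mem_zpowers x))
  have e : α x = g * x ^ m * g⁻¹ := by rw [hm]; group
  refine ⟨g, m, e, dvd_of_zpow_mem hG hx ?_⟩
  have h1 := hl x
  rw [e, ← mk'_eq_one_iff] at h1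
  rw [← mk'_eq_one_iff]
  simp only [map_mul, map_inv, map_zpow, map_pow] at h1 ⊢
  rwa [(commute_quotient_commutator (QuotientGroup.mk' _ g) _).eq, mul_inv_cancel_right,
    ← zpow_natCast, ← zpow_sub] at h1

/-- For x ∉ A, modulo B the element x^p is raised to the power λ² as an element of A, and to a power
m ≡ λ because α(x) is conjugate to x^m. Since λ² ≠ λ, it is trivial there. -/
theorem IsIntense.pow_mem_gammaThree (hG : IsPGroup p G) (h : ∀ x : G, x ^ p ∈ commutator G)
    {α : MulAut G} (hα : IsIntense α) {l : ℕ} (hl : ∀ x, α x * (x ^ l)⁻¹ ∈ commutator G)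
    (hl0 : ¬ (p : ℤ) ∣ l) (hl1 : ¬ (p : ℤ) ∣ l - 1) (x : G) : x ^ p ∈ gammaThree G := by
  by_cases hx : x ∈ commutator G
  · exact pow_mem_gammaThree_of_mem_commutator h hx
  obtain ⟨g, m, e, hml⟩ := hα.exists_zpow_conj hG hl hx
  set q := QuotientGroup.mk' (gammaThree G) with hqdef
  have e1 : q (α (x ^ p)) = q (x ^ p) ^ (m : ℤ) := by
    have e2 : α (x ^ p) = g * (x ^ p) ^ m * g⁻¹ := by
      rw [map_pow, e, conj_pow, ← zpow_natCast, ← zpow_natCast, ← zpow_mul, ← zpow_mul, mul_comm]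
    rw [e2, map_mul, map_mul, map_inv, map_zpow,
      Subgroup.mem_center_iff.mp (zpow_mem (mk'_mem_center le_rfl (h x)) m), mul_inv_cancel_right]
  rw [mk'_apply_eq_pow_of_mem_commutator hl (h x)] at e1
  refine hG.mem_of_zpow_mem (i := (l : ℤ) * l - m) (fun hd => not_dvd_mul_sub hl0 hl1 ?_) ?_
  · have := dvd_add hd hml
    ring_nf at this ⊢
    exact this
  · rw [← mk'_eq_one_iff, map_zpow, zpow_sub, ← e1, mul_inv_eq_one]
    exact_mod_cast rfl

end Forward

/-! ### Comparing conjugators on two-generator subgroups -/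

section

variable {p : ℕ} {G : Type*} [Group G]

/-- In the normal form z^i x^j [z,x]^k t an element of A has i and j divisible by p, and p-th powers
lie in B. -/
theorem mem_zpowers_sup_of_mem_closure_pair {z x : G} (hpow : ∀ x : G, x ^ p ∈ gammaThree G)
    (hind : ∀ i j : ℤ, z ^ i * x ^ j ∈ commutator G → (p : ℤ) ∣ i ∧ (p : ℤ) ∣ j) {g : G}
    (hg : g ∈ Subgroup.closure {z, x} ⊔ gammaThree G) (hgA : g ∈ commutator G) :
    g ∈ Subgroup.zpowers ⁅z, x⁆ ⊔ gammaThree G := by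
  have hc := commutatorElement_mem_commutator z x
  obtain ⟨i, j, k, t, ht, rfl⟩ := exists_zpow_of_mem_closure_pair_sup
    (commutatorElement_mem_gammaThree_right hc z) (commutatorElement_mem_gammaThree_right hc x) hg
  rw [mul_assoc, Subgroup.mul_mem_cancel_right _
    (mul_mem (zpow_mem hc k) (gammaThree_le_commutator ht))] at hgA
  obtain ⟨hi, hj⟩ := hind i j hgA
  refine mul_mem (mul_mem (mul_mem ?_ ?_) ?_) ?_
  · exact Subgroup.mem_sup_right (zpow_mem_of_dvd (hpow z) hi)
  · exact Subgroup.mem_sup_right (zpow_mem_of_dvd (hpow x) hj)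
  · exact Subgroup.mem_sup_left (zpow_mem (Subgroup.mem_zpowers _) k)
  · exact Subgroup.mem_sup_right ht

theorem conj_apply_mul_mem_commutator {α : MulAut G} {l : ℕ}
    (hl : ∀ x, α x * (x ^ l)⁻¹ ∈ commutator G) (g h : G) :
    g⁻¹ * α h * g * (h ^ l)⁻¹ ∈ commutator G := by
  have h1 : g⁻¹ * (α h * (h ^ l)⁻¹) * g⁻¹⁻¹ ∈ commutator G :=
    Subgroup.Normal.conj_mem inferInstance _ (hl h) g⁻¹
  have h2 := mul_mem h1 (commutatorElement_mem_commutator g⁻¹ (h ^ l))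
  rw [commutatorElement_def] at h2
  convert h2 using 1
  group

theorem mul_zpow_mul_inv_mem_commutator {x w : G} (hw : w ∈ commutator G) (j : ℤ) :
    (x * w) ^ j * (x ^ j)⁻¹ ∈ commutator G := by
  rw [← mk'_eq_one_iff] at hw ⊢
  rw [map_mul, map_zpow, map_mul, hw, mul_one, ← map_zpow, ← map_mul, mul_inv_cancel, map_one]

theorem indep_mul_right {z x w : G} (hw : w ∈ commutator G)
    (hind : ∀ i j : ℤ, z ^ i * x ^ j ∈ commutator G → (p : ℤ) ∣ i ∧ (p : ℤ) ∣ j) (i j : ℤ)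
    (h : z ^ i * (x * w) ^ j ∈ commutator G) : (p : ℤ) ∣ i ∧ (p : ℤ) ∣ j := by
  refine hind i j ?_
  have h1 := mul_zpow_mul_inv_mem_commutator (x := x) hw j
  rw [← mk'_eq_one_iff] at h1 h ⊢
  rw [map_mul, map_inv, mul_inv_eq_one] at h1
  rwa [map_mul, ← h1, ← map_mul]

variable [Fact p.Prime]

/-- Comparing an intense automorphism on the subgroups `⟨z, x⟩` and `⟨z, xw⟩`. -/
theorem IsIntense.exists_commutatorElement_mem (hG : IsPGroup p G)
    {α : MulAut G} (hα : IsIntense α) {l : ℕ} (hl : ∀ x, α x * (x ^ l)⁻¹ ∈ commutator G)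
    (hl0 : ¬ (p : ℤ) ∣ l) (hpow : ∀ x : G, x ^ p ∈ gammaThree G) {z x w : G}
    (hind : ∀ i j : ℤ, z ^ i * x ^ j ∈ commutator G → (p : ℤ) ∣ i ∧ (p : ℤ) ∣ j)
    (hw : w ∈ commutator G) :
    ∃ h : G, ⁅h, z⁆ ∈ Subgroup.zpowers ⁅z, x⁆ ⊔ gammaThree G ∧
      ⁅h, x⁆ * (w ^ (1 - (l : ℤ)))⁻¹ ∈ Subgroup.zpowers ⁅z, x⁆ ⊔ gammaThree G := by
  have hc := commutatorElement_mem_commutator z x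
  have hn : (Subgroup.zpowers ⁅z, x⁆ ⊔ gammaThree G).Normal := gammaThree_sup_zpowers_normal hc
  set Y := Subgroup.zpowers ⁅z, x⁆ ⊔ gammaThree G with hY
  have hBY : gammaThree G ≤ Y := le_sup_right
  have hxw : Subgroup.zpowers ⁅z, x * w⁆ ⊔ gammaThree G ≤ Y := by
    refine sup_le (Subgroup.zpowers_le.mpr ?_) hBY
    rw [commutatorElement_mul_right_eq_mul_conj, mul_assoc, mul_assoc, ← mul_assoc x]
    exact mul_mem (Subgroup.mem_sup_left (Subgroup.mem_zpowers _))
      (hn.conj_mem _ (hBY (commutatorElement_mem_gammaThree_right hw z)) x)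
  -- Conjugated back by g, the element α(u) lies in ⟨z,x'⟩B, as does u^l. They agree modulo A, hence
  -- modulo the part of ⟨z,x'⟩B inside A, which Y contains.
  have key : ∀ x', (∀ i j : ℤ, z ^ i * x' ^ j ∈ commutator G → (p : ℤ) ∣ i ∧ (p : ℤ) ∣ j) →
      Subgroup.zpowers ⁅z, x'⁆ ⊔ gammaThree G ≤ Y → ∃ g, ∀ u, u = z ∨ u = x' →
        QuotientGroup.mk' Y (α u) = QuotientGroup.mk' Y (g * u ^ l * g⁻¹) := by
    intro x' hi hle
    obtain ⟨g, hg⟩ := hα.exists_conj_mem (Subgroup.closure {z, x'} ⊔ gammaThree G)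
    refine ⟨g, fun u hu => ?_⟩
    have huH : u ∈ Subgroup.closure {z, x'} ⊔ gammaThree G :=
      Subgroup.mem_sup_left (Subgroup.subset_closure hu)
    have h1 := hle (mem_zpowers_sup_of_mem_closure_pair hpow hi
      (mul_mem (hg u huH) (inv_mem (pow_mem huH l))) (conj_apply_mul_mem_commutator hl g u))
    rw [← mk'_eq_one_iff, map_mul, map_inv, mul_inv_eq_one] at h1
    rw [map_mul, map_mul, ← h1, ← map_mul, ← map_mul]
    congr 1
    group
  obtain ⟨g₁, h₁⟩ := key x hind le_rfl
  obtain ⟨g₂, h₂⟩ := key (x * w) (indep_mul_right hw hind) hxw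
  have hcc := commutatorElement_quotient_mem_center hBY
  set q := QuotientGroup.mk' Y with hq
  have hWc : q w ∈ Subgroup.center (G ⧸ Y) := mk'_mem_center hBY hw
  -- On z both conjugators describe α, so the quotient centralises z^l modulo Y. On x the
  -- discrepancy is w^l against α(w) ≡ w^(l²); the exponent l - l² = l(1 - l) gives the claim after
  -- cancelling l.
  refine ⟨g₂⁻¹ * g₁, ?_, ?_⟩
  · refine hG.mem_of_zpow_mem hl0 ?_
    have e := (h₁ z (Or.inl rfl)).symm.trans (h₂ z (Or.inl rfl))
    rw [← mk'_eq_one_iff, map_zpow, map_commutatorElement,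
      ← commutatorElement_zpow_right_of_central (fun b => hcc _ b), ← map_zpow,
      ← map_commutatorElement, commutatorElement_def, zpow_natCast]
    have e2 : g₂⁻¹ * g₁ * z ^ l * (g₂⁻¹ * g₁)⁻¹ * (z ^ l)⁻¹
      = g₂⁻¹ * (g₁ * z ^ l * g₁⁻¹) * (g₂⁻¹ * (g₂ * z ^ l * g₂⁻¹))⁻¹ := by group
    rw [e2, map_mul, map_inv, map_mul q g₂⁻¹ (g₁ * _ * _), map_mul q g₂⁻¹, e, mul_inv_cancel]
  · refine hG.mem_of_zpow_mem hl0 ?_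
    have e1 := h₁ x (Or.inr rfl)
    have e2 := h₂ (x * w) (Or.inr rfl)
    have e3 : q (α w) = q w ^ (l * l) := by
      have := mk'_apply_eq_pow_of_mem_commutator hl hw
      rw [← map_pow, ← mul_inv_eq_one, ← map_inv, ← map_mul, mk'_eq_one_iff] at this
      rw [← map_pow, ← mul_inv_eq_one, ← map_inv, ← map_mul, mk'_eq_one_iff]
      exact hBY this
    have hWp : ∀ (k : ℤ) (g : G ⧸ Y), Commute g (q w ^ k) := fun k g =>
      Subgroup.mem_center_iff.mp (zpow_mem hWc k) g
    have hxw : q ((x * w) ^ l) = q x ^ l * q w ^ l := by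
      rw [map_pow, map_mul]
      exact Commute.mul_pow (Subgroup.mem_center_iff.mp hWc _) l
    rw [map_mul, map_mul, e1, e3, map_mul q (g₂ * _), map_mul q g₂ _, hxw] at e2
    have e4 : q ⁅g₂⁻¹ * g₁, x ^ l⁆ = q w ^ ((l : ℤ) - l * l) := by
      have e5 : q g₁ * q (x ^ l) * q g₁⁻¹ = q g₂ * q x ^ l * q g₂⁻¹ * q w ^ ((l : ℤ) - l * l) := by
        have := hWp l (q g₂⁻¹)
        rw [zpow_natCast] at this
        rw [zpow_sub, ← mul_assoc, eq_mul_inv_iff_mul_eq]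
        simp only [map_mul] at e2
        rw [mul_assoc (q g₂) _ (q g₂⁻¹), mul_assoc (q x ^ l), ← this.eq] at e2
        simp only [mul_assoc] at e2 ⊢
        exact_mod_cast e2
      have e6 : ⁅g₂⁻¹ * g₁, x ^ l⁆ = g₂⁻¹ * (g₁ * x ^ l * g₁⁻¹) * g₂ * (x ^ l)⁻¹ := by
        rw [commutatorElement_def]; group
      rw [e6, map_mul, map_mul, map_mul, map_mul, map_mul, e5, mul_assoc, mul_assoc,
        mul_assoc _ (q w ^ _), ← (hWp _ _).eq]
      simp only [map_inv, map_pow]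
      group
    rw [← mk'_eq_one_iff, map_zpow, map_mul]
    have hcm : Commute (q ⁅g₂⁻¹ * g₁, x⁆) (q (w ^ (1 - (l : ℤ)))⁻¹) := by
      rw [← zpow_neg, map_zpow]; exact hWp _ _
    rw [hcm.mul_zpow, map_commutatorElement,
      ← commutatorElement_zpow_right_of_central (fun b => hcc _ b), ← map_zpow,
      ← map_commutatorElement, zpow_natCast, e4, ← zpow_neg, map_zpow, ← zpow_mul, ← zpow_add]
    ring_nf
    simp

end

/-! ### The commutator subgroup has index p² -/

section

variable {p : ℕ} {G : Type*} [Group G]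

/-- Conjugation by z changes h and x by central factors, which do not affect [h,x]. -/
theorem commute_commutatorElement_of_mem_center {z h x : G}
    (hh : ⁅h, z⁆ ∈ Subgroup.center G) (hx : ⁅x, z⁆ ∈ Subgroup.center G) : Commute z ⁅h, x⁆ := by
  have key : ∀ u : G, ⁅u, z⁆ ∈ Subgroup.center G → z * u * z⁻¹ = u * ⁅u, z⁆⁻¹ := by
    intro u hu
    rw [Subgroup.mem_center_iff.mp (inv_mem hu) u, commutatorElement_def]
    group
  have e := conjugate_commutatorElement h x z
  rw [key h hh, key x hx, commutatorElement_mul_center_left (inv_mem hh),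
    commutatorElement_mul_center_right (inv_mem hx)] at e
  exact mul_inv_eq_iff_eq_mul.mp e

variable [Fact p.Prime]

theorem indep_of_notMem (hG : IsPGroup p G) (hpow : ∀ x : G, x ^ p ∈ commutator G) {z x : G}
    (hz : z ∉ commutator G) (hx : x ∉ Subgroup.zpowers z ⊔ commutator G) (i j : ℤ)
    (h : z ^ i * x ^ j ∈ commutator G) : (p : ℤ) ∣ i ∧ (p : ℤ) ∣ j := by
  have hj : (p : ℤ) ∣ j := dvd_of_zpow_mem hG hx <|
    (Subgroup.mul_mem_cancel_left _ (Subgroup.mem_sup_left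
      (zpow_mem (Subgroup.mem_zpowers z) i))).mp (Subgroup.mem_sup_right h)
  refine ⟨dvd_of_zpow_mem hG hz ?_, hj⟩
  exact ((commutator G).mul_mem_cancel_right (zpow_mem_of_dvd (hpow x) hj)).mp h

/-- The elements z^i x^j with 0 ≤ i, j < p represent every coset exactly once. -/
theorem commutator_index_eq (hG : IsPGroup p G) (hpow : ∀ x : G, x ^ p ∈ commutator G) {z x : G}
    (hz : z ∉ commutator G) (hx : x ∉ Subgroup.zpowers z ⊔ commutator G)
    (hgen : ∀ g : G, ∃ i j : ℤ, ∃ a ∈ commutator G, g = z ^ i * x ^ j * a) :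
    (commutator G).index = p ^ 2 := by
  have hp0 : (p : ℤ) ≠ 0 := by exact_mod_cast (Fact.out : p.Prime).ne_zero
  set q := QuotientGroup.mk' (commutator G) with hq
  let f : Fin p × Fin p → G ⧸ commutator G := fun ij => q (z ^ (ij.1 : ℤ) * x ^ (ij.2 : ℤ))
  have hf : Function.Bijective f := by
    constructor
    · rintro ⟨i, j⟩ ⟨i', j'⟩ h
      have h1 : q (z ^ ((i : ℤ) - i') * x ^ ((j : ℤ) - j')) = 1 := by
        have h2 : q z ^ (i : ℤ) * q x ^ (j : ℤ) = q z ^ (i' : ℤ) * q x ^ (j' : ℤ) := by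
          simpa only [f, map_mul, map_zpow] using h
        have h3 : q z ^ (i : ℤ) = q z ^ (i' : ℤ) * q x ^ (j' : ℤ) * (q x ^ (j : ℤ))⁻¹ :=
          eq_mul_inv_of_mul_eq h2
        rw [map_mul, map_zpow, map_zpow, sub_eq_neg_add, zpow_add, h3, zpow_sub]
        have := commute_quotient_commutator (q x ^ (j : ℤ)) (q x ^ (j' : ℤ))⁻¹
        rw [this.eq]
        group
      obtain ⟨hi, hj⟩ := indep_of_notMem hG hpow hz hx _ _ (mk'_eq_one_iff.mp h1)
      have aux : ∀ a b : Fin p, (p : ℤ) ∣ (a : ℤ) - b → a = b := by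
        intro a b hab
        have ha := a.2
        have hb := b.2
        have := Int.eq_zero_of_abs_lt_dvd hab (by rw [abs_lt]; constructor <;> omega)
        exact Fin.ext (by omega)
      rw [aux i i' hi, aux j j' hj]
    · intro v
      obtain ⟨g, rfl⟩ := QuotientGroup.mk'_surjective _ v
      obtain ⟨i, j, a, ha, rfl⟩ := hgen g
      have red : ∀ (u : G) (i : ℤ), ∃ k : Fin p, q u ^ (k : ℤ) = q u ^ i := by
        intro u i
        refine ⟨⟨(i % p).toNat, ?_⟩, ?_⟩
        · have := Int.emod_lt_of_pos i (b := p) (by omega)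
          omega
        · have h1 : q u ^ (p : ℤ) = 1 := by
            rw [zpow_natCast, ← map_pow]; exact mk'_eq_one_iff.mpr (hpow u)
          conv_rhs => rw [← Int.emod_add_mul_ediv i p, zpow_add, zpow_mul, h1, one_zpow, mul_one]
          rw [Int.toNat_of_nonneg (Int.emod_nonneg i hp0)]
      obtain ⟨k, hk⟩ := red z i
      obtain ⟨k', hk'⟩ := red x j
      refine ⟨(k, k'), ?_⟩
      have ha1 : q a = 1 := mk'_eq_one_iff.mpr ha
      change q (z ^ (k : ℤ) * x ^ (k' : ℤ)) = q _
      rw [map_mul, map_mul, map_mul, ha1, mul_one]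
      simp only [map_zpow]
      rw [hk, hk']
  rw [Subgroup.index_eq_card, ← Nat.card_eq_of_bijective f hf]
  simp [sq]

/-- If a finite `p`-group of class three has an intense automorphism with non-trivial character,
then its commutator subgroup has index `p ^ 2`. -/
theorem IsIntense.commutator_index (hG : IsPGroup p G) (hB : gammaThree G ≤ Subgroup.center G)
    (hB0 : gammaThree G ≠ ⊥) (hpowA : ∀ x : G, x ^ p ∈ commutator G) {α : MulAut G}
    (hα : IsIntense α) {l : ℕ} (hl : ∀ x, α x * (x ^ l)⁻¹ ∈ commutator G)
    (hl0 : ¬ (p : ℤ) ∣ l) (hl1 : ¬ (p : ℤ) ∣ l - 1) : (commutator G).index = p ^ 2 := by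
  have hpow : ∀ x : G, x ^ p ∈ gammaThree G := hα.pow_mem_gammaThree hG hpowA hl hl0 hl1
  have hl1' : ¬ (p : ℤ) ∣ 1 - l := fun h => hl1 (by rwa [← dvd_neg, neg_sub])
  have hsup := zpowers_sup_commutator_ne_top hB hB0
  have hA : commutator G ≠ ⊤ := fun h => hsup 1 (top_le_iff.mp (h ▸ le_sup_right))
  obtain ⟨w₀, hw₀, z', hz'⟩ := exists_commutatorElement_notMem (H := commutator G) (N := ⊥)
    (fun h => hB0 (le_bot_iff.mp h))
  -- Elements outside A generate G, so one of them fails to centralise w₀.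
  obtain ⟨z, hz, hzw⟩ : ∃ z, z ∉ commutator G ∧ ¬ Commute z w₀ := by
    by_contra! hc
    have : Subgroup.centralizer {w₀} = ⊤ := Subgroup.eq_top_of_forall_notMem hA fun g hg =>
      Subgroup.mem_centralizer_singleton_iff.mpr (hc g hg).eq
    have h2 : z' ∈ Subgroup.centralizer {w₀} := this ▸ Subgroup.mem_top z'
    exact hz' (Subgroup.mem_bot.mpr (commutatorElement_eq_one_iff_mul_comm.mpr
      (Subgroup.mem_centralizer_singleton_iff.mp h2).symm))
  -- Otherwise [z,x] ∈ B and the comparison gives h with [h,z] ∈ B and [h,x] ≡ w₀^(1-l) modulo B.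
  -- Then z commutes with [h,x], hence with w₀.
  have claim1 : ∀ x : G, ⁅x, z⁆ ∈ gammaThree G → x ∈ Subgroup.zpowers z ⊔ commutator G := by
    intro x hx
    by_contra hxz
    have hzx : ⁅z, x⁆ ∈ gammaThree G := by rw [← commutatorElement_inv]; exact inv_mem hx
    obtain ⟨h, h1, h2⟩ := hα.exists_commutatorElement_mem hG hl hl0 hpow
      (indep_of_notMem hG hpowA hz hxz) hw₀
    rw [sup_eq_right.mpr (Subgroup.zpowers_le.mpr hzx)] at h1 h2
    have h3 := commute_commutatorElement_of_mem_center (hB h1) (hB hx)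
    have h4 : Commute z (⁅h, x⁆ * (w₀ ^ (1 - (l : ℤ)))⁻¹) := Subgroup.mem_center_iff.mp (hB h2) z
    have h5 : Commute z (w₀ ^ (1 - (l : ℤ))) := by
      have := (h3.inv_right.mul_right h4).inv_right
      rwa [inv_mul_cancel_left, inv_inv] at this
    have h6 : w₀ ∈ Subgroup.centralizer {z} := hG.mem_of_zpow_mem hl1'
      (Subgroup.mem_centralizer_singleton_iff.mpr h5.symm.eq)
    exact hzw (Subgroup.mem_centralizer_singleton_iff.mp h6).symm
  obtain ⟨x, hx⟩ : ∃ x, x ∉ Subgroup.zpowers z ⊔ commutator G := by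
    by_contra! hc
    exact hsup z ((Subgroup.eq_top_iff' _).mpr hc)
  have hn : (Subgroup.zpowers ⁅z, x⁆ ⊔ gammaThree G).Normal :=
    gammaThree_sup_zpowers_normal (commutatorElement_mem_commutator z x)
  -- If [h,z] ≡ [z,x]^k modulo B, then [h x^k, z] ∈ B, and `claim1` applies to h x^k.
  have claim2 : ∀ h : G, ⁅h, z⁆ ∈ Subgroup.zpowers ⁅z, x⁆ ⊔ gammaThree G →
      ∃ k i : ℤ, ∃ a ∈ commutator G, h = z ^ i * a * x ^ k := by
    intro h hh
    obtain ⟨_, ⟨k, rfl⟩, b, hb, e⟩ := Subgroup.mem_sup_of_normal_right.mp hh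
    have h1 : h * x ^ k ∈ Subgroup.zpowers z ⊔ commutator G := by
      refine claim1 _ ?_
      have hcc := commutatorElement_quotient_mem_center (G := G) (N := gammaThree G) le_rfl
      rw [← mk'_eq_one_iff] at hb ⊢
      have e' := congrArg (QuotientGroup.mk' (gammaThree G)) e
      rw [map_mul, hb, mul_one, map_zpow, map_commutatorElement, map_commutatorElement] at e'
      rw [map_commutatorElement, map_mul, map_zpow,
        commutatorElement_mul_left_of_central (hcc _ _),
        commutatorElement_zpow_left_of_central (fun b => hcc b _), ← e', ← commutatorElement_inv,
        inv_zpow, inv_mul_cancel]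
    obtain ⟨_, ⟨i, rfl⟩, a, ha, e2⟩ := Subgroup.mem_sup_of_normal_right.mp h1
    exact ⟨-k, i, a, ha, by rw [e2]; group⟩
  -- By `claim2` the h of the comparison is a product of powers of z and x with an element of A, so
  -- [h,x] lies in ⟨[z,x]⟩B, and with it w^(1-l).
  have hAY : commutator G ≤ Subgroup.zpowers ⁅z, x⁆ ⊔ gammaThree G := by
    intro w hw
    obtain ⟨h, h1, h2⟩ := hα.exists_commutatorElement_mem hG hl hl0 hpow
      (indep_of_notMem hG hpowA hz hx) hw
    obtain ⟨k, i, a, ha, rfl⟩ := claim2 h h1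
    refine hG.mem_of_zpow_mem hl1' ?_
    have h3 : ⁅z ^ i * a * x ^ k, x⁆ ∈ Subgroup.zpowers ⁅z, x⁆ ⊔ gammaThree G := by
      set Y := Subgroup.zpowers ⁅z, x⁆ ⊔ gammaThree G
      have hBY : gammaThree G ≤ Y := le_sup_right
      have hcc := commutatorElement_quotient_mem_center hBY
      have h4 : ⁅QuotientGroup.mk' Y z, QuotientGroup.mk' Y x⁆ = 1 := by
        rw [← map_commutatorElement, mk'_eq_one_iff]
        exact Subgroup.mem_sup_left (Subgroup.mem_zpowers _)
      rw [← mk'_eq_one_iff, map_commutatorElement, map_mul, map_mul, map_zpow, map_zpow,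
        commutatorElement_mul_left_of_central (hcc _ _),
        commutatorElement_mul_center_left (mk'_mem_center hBY ha),
        commutatorElement_zpow_left_of_central (fun b => hcc b _),
        commutatorElement_zpow_left_of_central (fun b => hcc b _), h4, commutatorElement_self]
      simp
    have h5 := mul_mem (inv_mem h2) h3
    rwa [mul_inv_rev, inv_inv, inv_mul_cancel_right] at h5
  refine commutator_index_eq hG hpowA hz hx fun g => ?_
  -- As A ≤ ⟨[z,x]⟩B, the hypothesis of `claim2` now holds for every element of G.
  obtain ⟨k, i, a, ha, rfl⟩ := claim2 g (hAY (commutatorElement_mem_commutator g z))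
  refine ⟨i, k, (x ^ k)⁻¹ * a * x ^ k, ?_, by group⟩
  simpa using Subgroup.Normal.conj_mem inferInstance a ha (x ^ k)⁻¹

end

theorem commutatorElement_zpow_right_of_mem_center {G : Type*} [Group G] {v c : G}
    (h : ⁅v, c⁆ ∈ Subgroup.center G) (n : ℤ) : ⁅v, c ^ n⁆ = ⁅v, c⁆ ^ n := by
  have e : Commute ⁅v, c⁆ c := (Subgroup.mem_center_iff.mp h c).symm
  have e2 : v * c * v⁻¹ = ⁅v, c⁆ * c := by rw [commutatorElement_def]; group
  rw [commutatorElement_def v, ← conj_zpow, e2, e.mul_zpow, mul_inv_cancel_right]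

/-- A `p`-group of class three, with `p` odd and commutator subgroup of index `p ^ 2`. -/
structure IsClassThreeIndexSq (p : ℕ) (G : Type*) [Group G] : Prop where
  isPGroup : IsPGroup p G
  odd : Odd p
  le_center : gammaThree G ≤ Subgroup.center G
  ne_bot : gammaThree G ≠ ⊥
  index_eq : (commutator G).index = p ^ 2

/-! ### Structure when the commutator subgroup has index p², and the bound λ² = 1 -/

namespace IsClassThreeIndexSq

variable {p : ℕ} {G : Type*} [Group G]

theorem exists_pair (h : IsClassThreeIndexSq p G) :
    ∃ x y : G, x ∉ commutator G ∧ y ∉ Subgroup.zpowers x ⊔ commutator G := by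
  have hs := zpowers_sup_commutator_ne_top h.le_center h.ne_bot
  obtain ⟨x, hx⟩ : ∃ x, x ∉ commutator G := by
    by_contra! hc
    exact hs 1 (top_le_iff.mp (((Subgroup.eq_top_iff' _).mpr hc).ge.trans le_sup_right))
  obtain ⟨y, hy⟩ : ∃ y, y ∉ Subgroup.zpowers x ⊔ commutator G := by
    by_contra! hc
    exact hs x ((Subgroup.eq_top_iff' _).mpr hc)
  exact ⟨x, y, hx, hy⟩

theorem commutatorElement_mem_center (h : IsClassThreeIndexSq p G) {c : G}
    (hc : c ∈ commutator G) (u : G) : ⁅u, c⁆ ∈ Subgroup.center G :=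
  h.le_center (commutatorElement_mem_gammaThree_right hc u)

variable [Fact p.Prime]

theorem relIndex_eq (h : IsClassThreeIndexSq p G) {x : G} (hx : x ∉ commutator G) :
    (commutator G).relIndex (Subgroup.zpowers x ⊔ commutator G) = p ∧
      (Subgroup.zpowers x ⊔ commutator G).index = p := by
  have hp : p.Prime := Fact.out
  have h1 := Subgroup.relIndex_mul_index
    (le_sup_right : commutator G ≤ Subgroup.zpowers x ⊔ commutator G)
  rw [h.index_eq] at h1
  have h2 : (Subgroup.zpowers x ⊔ commutator G).index ≠ 1 := fun e =>
    zpowers_sup_commutator_ne_top h.le_center h.ne_bot x (Subgroup.index_eq_one.mp e)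
  have h3 : (commutator G).relIndex (Subgroup.zpowers x ⊔ commutator G) ≠ 1 := fun e =>
    hx (Subgroup.relIndex_eq_one.mp e (Subgroup.mem_sup_left (Subgroup.mem_zpowers x)))
  exact (Nat.Prime.mul_eq_prime_sq_iff hp h3 h2).mp h1

theorem pow_mem_commutator (h : IsClassThreeIndexSq p G) (x : G) : x ^ p ∈ commutator G := by
  by_cases hx : x ∈ commutator G
  · exact pow_mem hx p
  have h1 := Subgroup.pow_index_mem ((commutator G).subgroupOf (Subgroup.zpowers x ⊔ commutator G))
    ⟨x, Subgroup.mem_sup_left (Subgroup.mem_zpowers x)⟩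
  change _ ^ (commutator G).relIndex _ ∈ _ at h1
  rw [(h.relIndex_eq hx).1] at h1
  exact h1

theorem exists_eq_mul (h : IsClassThreeIndexSq p G) {x y : G} (hx : x ∉ commutator G)
    (hy : y ∉ Subgroup.zpowers x ⊔ commutator G) (g : G) :
    ∃ i j : ℤ, ∃ a ∈ commutator G, g = x ^ i * y ^ j * a := by
  have hn : (Subgroup.zpowers x ⊔ commutator G).Normal :=
    Subgroup.Normal.of_commutator_le _ le_sup_right
  have hcard : Nat.card (G ⧸ (Subgroup.zpowers x ⊔ commutator G)) = p := (h.relIndex_eq hx).2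
  obtain ⟨j, hj⟩ := Subgroup.mem_zpowers_iff.mp (mem_zpowers_of_prime_card hcard
    (g := (y : G ⧸ (Subgroup.zpowers x ⊔ commutator G))) (g' := (g : G ⧸ _))
    (fun e => hy ((QuotientGroup.eq_one_iff y).mp e)))
  rw [← QuotientGroup.mk_zpow, QuotientGroup.eq] at hj
  have h2 := hn.conj_mem _ hj (y ^ j)
  obtain ⟨_, ⟨i, rfl⟩, a, ha, e⟩ := Subgroup.mem_sup_of_normal_right.mp h2
  refine ⟨i, j, (y ^ j)⁻¹ * a * y ^ j, ?_, ?_⟩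
  · simpa using Subgroup.Normal.conj_mem inferInstance a ha (y ^ j)⁻¹
  · have : x ^ i * a = g * (y ^ j)⁻¹ := by rw [show x ^ i * a = _ from e]; group
    calc g = (x ^ i * a) * y ^ j := by rw [this]; group
      _ = _ := by group

/-- Modulo ⟨[x,y]⟩B the elements x and y commute and A is central, so the quotient is abelian. -/
theorem commutator_le (h : IsClassThreeIndexSq p G) {x y : G} (hx : x ∉ commutator G)
    (hy : y ∉ Subgroup.zpowers x ⊔ commutator G) :
    commutator G ≤ Subgroup.zpowers ⁅x, y⁆ ⊔ gammaThree G := by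
  have hn : (Subgroup.zpowers ⁅x, y⁆ ⊔ gammaThree G).Normal :=
    gammaThree_sup_zpowers_normal (commutatorElement_mem_commutator x y)
  set Y := Subgroup.zpowers ⁅x, y⁆ ⊔ gammaThree G
  have hBY : gammaThree G ≤ Y := le_sup_right
  refine Subgroup.commutator_le.mpr fun u _ v _ => ?_
  obtain ⟨i, j, a, ha, rfl⟩ := h.exists_eq_mul hx hy u
  obtain ⟨i', j', a', ha', rfl⟩ := h.exists_eq_mul hx hy v
  have h4 : Commute (QuotientGroup.mk' Y x) (QuotientGroup.mk' Y y) := by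
    rw [← commutatorElement_eq_one_iff_commute, ← map_commutatorElement, mk'_eq_one_iff]
    exact Subgroup.mem_sup_left (Subgroup.mem_zpowers _)
  rw [← mk'_eq_one_iff, map_commutatorElement, map_mul, map_mul,
    commutatorElement_mul_center_left (mk'_mem_center hBY ha),
    map_mul _ _ a',
    commutatorElement_mul_center_right (mk'_mem_center hBY ha'), map_mul _ (x ^ i'),
    map_zpow, map_zpow, map_zpow, map_zpow, commutatorElement_eq_one_iff_commute]
  exact (((Commute.refl _).zpow_zpow _ _).mul_right (h4.zpow_zpow _ _)).mul_left
    ((h4.symm.zpow_zpow _ _).mul_right ((Commute.refl _).zpow_zpow _ _))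

theorem commutatorElement_notMem (h : IsClassThreeIndexSq p G) {x y : G} (hx : x ∉ commutator G)
    (hy : y ∉ Subgroup.zpowers x ⊔ commutator G) : ⁅x, y⁆ ∉ gammaThree G := fun hc =>
  not_commutator_le_gammaThree h.le_center h.ne_bot <| (h.commutator_le hx hy).trans
    (sup_le (Subgroup.zpowers_le.mpr hc) le_rfl)

/-- A/B is generated by [x,y] and has exponent p, so each of its non-trivial elements generates it.
-/
theorem exists_eq_zpow_mul (h : IsClassThreeIndexSq p G) {c : G} (hc : c ∈ commutator G)
    (hcB : c ∉ gammaThree G) {a : G} (ha : a ∈ commutator G) :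
    ∃ k : ℤ, ∃ t ∈ gammaThree G, a = c ^ k * t := by
  obtain ⟨x, y, hx, hy⟩ := h.exists_pair
  have hle : commutator G ≤ Subgroup.zpowers c ⊔ gammaThree G := by
    refine (h.commutator_le hx hy).trans (sup_le (Subgroup.zpowers_le.mpr ?_) le_sup_right)
    obtain ⟨_, ⟨k, rfl⟩, t, ht, e⟩ := Subgroup.mem_sup_of_normal_right.mp (h.commutator_le hx hy hc)
    refine h.isPGroup.mem_of_zpow_mem (i := k) (fun hk => hcB ?_) ?_
    · rw [← e]
      exact mul_mem (zpow_mem_of_dvd (pow_mem_gammaThree_of_mem_commutator h.pow_mem_commutator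
        (commutatorElement_mem_commutator x y)) hk) ht
    · rw [show ⁅x, y⁆ ^ k = c * t⁻¹ from eq_mul_inv_of_mul_eq e]
      exact mul_mem (Subgroup.mem_sup_left (Subgroup.mem_zpowers c))
        (Subgroup.mem_sup_right (inv_mem ht))
  obtain ⟨_, ⟨k, rfl⟩, t, ht, e⟩ := Subgroup.mem_sup_of_normal_right.mp (hle ha)
  exact ⟨k, t, ht, e.symm⟩

theorem exists_notMem (h : IsClassThreeIndexSq p G) : ∃ c ∈ commutator G, c ∉ gammaThree G := by
  obtain ⟨x, y, hx, hy⟩ := h.exists_pair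
  exact ⟨_, commutatorElement_mem_commutator x y, h.commutatorElement_notMem hx hy⟩

theorem commute_of_mem_commutator (h : IsClassThreeIndexSq p G) {a b : G}
    (ha : a ∈ commutator G) (hb : b ∈ commutator G) : Commute a b := by
  obtain ⟨c, hc, hcB⟩ := h.exists_notMem
  obtain ⟨k, t, ht, rfl⟩ := h.exists_eq_zpow_mul hc hcB ha
  obtain ⟨j, s, hs, rfl⟩ := h.exists_eq_zpow_mul hc hcB hb
  rw [← commutatorElement_eq_one_iff_commute, commutatorElement_mul_center_left (h.le_center ht),
    commutatorElement_mul_center_right (h.le_center hs)]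
  exact ((Commute.refl c).zpow_zpow k j).commutator_eq

/-- Since A = ⟨c⟩B with B central, [A,G] is the image of the homomorphism u ↦ [u,c]. -/
theorem exists_commutatorElement_eq (h : IsClassThreeIndexSq p G) {c : G} (hc : c ∈ commutator G)
    (hcB : c ∉ gammaThree G) {t : G} (ht : t ∈ gammaThree G) : ∃ u : G, ⁅u, c⁆ = t := by
  have hle : gammaThree G ≤ (commutatorLeftHom c (h.commutatorElement_mem_center hc)).range := by
    refine Subgroup.commutator_le.mpr fun w hw g _ => ?_
    obtain ⟨k, s, hs, rfl⟩ := h.exists_eq_zpow_mul hc hcB hw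
    rw [commutatorElement_mul_center_left (h.le_center hs), ← commutatorElement_inv]
    refine inv_mem ⟨g ^ k, ?_⟩
    change ⁅g ^ k, c⁆ = ⁅g, c ^ k⁆
    rw [commutatorElement_zpow_left_of_central (h.commutatorElement_mem_center hc),
      commutatorElement_zpow_right_of_mem_center (h.commutatorElement_mem_center hc g)]
  exact hle ht

/-- For t = [u,c] one has t^p = [u^p,c], and u^p ∈ A commutes with c because A is abelian. -/
theorem pow_eq_one_of_mem_gammaThree (h : IsClassThreeIndexSq p G) {t : G}
    (ht : t ∈ gammaThree G) : t ^ p = 1 := by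
  obtain ⟨c, hc, hcB⟩ := h.exists_notMem
  obtain ⟨u, rfl⟩ := h.exists_commutatorElement_eq hc hcB ht
  rw [← commutatorElement_pow_left_of_central (h.commutatorElement_mem_center hc)]
  exact (h.commute_of_mem_commutator (h.pow_mem_commutator u) hc).commutator_eq

theorem dvd_choose_two (h : IsClassThreeIndexSq p G) : p ∣ p.choose 2 := by
  have hp : p.Prime := Fact.out
  refine hp.dvd_choose_self two_ne_zero (lt_of_le_of_ne hp.two_le ?_)
  rintro rfl
  exact absurd h.odd (by decide)

theorem exists_commutatorElement_ne_one (h : IsClassThreeIndexSq p G) {c : G}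
    (hc : c ∈ commutator G) (hcB : c ∉ gammaThree G) : ∃ u : G, ⁅u, c⁆ ≠ 1 := by
  obtain ⟨t, ht, ht1⟩ := (Subgroup.ne_bot_iff_exists_ne_one).mp h.ne_bot |> fun ⟨t, ht⟩ =>
    (⟨t, t.2, fun e => ht (Subtype.ext e)⟩ : ∃ t ∈ gammaThree G, t ≠ 1)
  obtain ⟨u, rfl⟩ := h.exists_commutatorElement_eq hc hcB ht
  exact ⟨u, ht1⟩

/-- If v^p ∉ B, then v^p generates A modulo B, and v, commuting with it, centralises c. Choose u not
centralising c; neither does uv, so u^p and (uv)^p lie in B. For odd p the p-th power map is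
multiplicative modulo B, so v^p ∈ B after all. -/
theorem pow_mem_gammaThree (h : IsClassThreeIndexSq p G) (v : G) : v ^ p ∈ gammaThree G := by
  obtain ⟨c, hc, hcB⟩ := h.exists_notMem
  have key : ∀ v : G, v ^ p ∉ gammaThree G → ⁅v, c⁆ = 1 := by
    intro v hv
    obtain ⟨k, t, ht, e⟩ := h.exists_eq_zpow_mul hc hcB (h.pow_mem_commutator v)
    have hk : ¬ (p : ℤ) ∣ k := fun hk => hv <| e ▸ mul_mem (zpow_mem_of_dvd
      (pow_mem_gammaThree_of_mem_commutator h.pow_mem_commutator hc) hk) ht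
    have h1 : v ∈ Subgroup.centralizer {c ^ k} := by
      have h2 : Commute v (c ^ k) := by
        rw [show c ^ k = v ^ p * t⁻¹ from eq_mul_inv_of_mul_eq e.symm]
        exact ((Commute.refl v).pow_right p).mul_right
          (Subgroup.mem_center_iff.mp (h.le_center (inv_mem ht)) v)
      exact Subgroup.mem_centralizer_singleton_iff.mpr h2.eq
    have h2 : c ∈ Subgroup.centralizer {v} := h.isPGroup.mem_of_zpow_mem hk
      (Subgroup.mem_centralizer_singleton_iff.mpr (Subgroup.mem_centralizer_singleton_iff.mp h1).symm)
    exact commutatorElement_eq_one_iff_mul_comm.mpr (Subgroup.mem_centralizer_singleton_iff.mp h2).symm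
  by_contra hv
  obtain ⟨u, hu⟩ := h.exists_commutatorElement_ne_one hc hcB
  have hup : u ^ p ∈ gammaThree G := by_contra fun hn => hu (key u hn)
  have huv : (u * v) ^ p ∈ gammaThree G := by
    refine by_contra fun hn => hu ?_
    have := key _ hn
    rwa [commutatorElement_mul_left_of_central (h.commutatorElement_mem_center hc v), key v hv,
      mul_one] at this
  apply hv
  rw [← mk'_eq_one_iff] at hup huv ⊢
  rw [map_pow, map_mul,
    mul_pow_of_central (commutatorElement_quotient_mem_center le_rfl _ _), ← map_pow, hup, one_mul,
    ← map_pow, ← map_commutatorElement, ← map_pow] at huv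
  obtain ⟨m, hm⟩ := h.dvd_choose_two
  have : QuotientGroup.mk' (gammaThree G) (⁅v, u⁆ ^ p.choose 2) = 1 := by
    rw [hm, pow_mul, mk'_eq_one_iff]
    exact pow_mem (pow_mem_gammaThree_of_mem_commutator h.pow_mem_commutator
      (commutatorElement_mem_commutator v u)) m
  rwa [this, mul_one] at huv

/-- Expand [x^p,y] = 1, where x^p ∈ B is central: the correction [x,[x,y]]^(p choose 2) vanishes for
odd p, leaving [x,y]^p = 1. -/
theorem pow_eq_one_of_mem_commutator (h : IsClassThreeIndexSq p G) {a : G}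
    (ha : a ∈ commutator G) : a ^ p = 1 := by
  obtain ⟨x, y, hx, hy⟩ := h.exists_pair
  have hc := commutatorElement_mem_commutator x y
  have hd : ⁅x, ⁅x, y⁆⁆ ∈ gammaThree G := commutatorElement_mem_gammaThree_right hc x
  have hcp : ⁅x, y⁆ ^ p = 1 := by
    have h1 := commutatorElement_pow_left (h.le_center hd) p
    obtain ⟨m, hm⟩ := h.dvd_choose_two
    rw [hm, pow_mul, h.pow_eq_one_of_mem_gammaThree hd, one_pow, mul_one,
      commutatorElement_of_mem_center_left (h.le_center (h.pow_mem_gammaThree x))] at h1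
    exact h1.symm
  obtain ⟨k, t, ht, rfl⟩ := h.exists_eq_zpow_mul hc (h.commutatorElement_notMem hx hy) ha
  have hcomm : Commute (⁅x, y⁆ ^ k) t := Subgroup.mem_center_iff.mp (h.le_center ht) _
  rw [hcomm.mul_pow, h.pow_eq_one_of_mem_gammaThree ht, mul_one, ← zpow_natCast, ← zpow_mul,
    mul_comm, zpow_mul, zpow_natCast, hcp, one_zpow]

theorem eq_top_of_mem (h : IsClassThreeIndexSq p G) {x y : G} (hx : x ∉ commutator G)
    (hy : y ∉ Subgroup.zpowers x ⊔ commutator G) {H : Subgroup G} (hxH : x ∈ H) (hyH : y ∈ H) :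
    H = ⊤ := by
  have hcH : ⁅x, y⁆ ∈ H := by
    rw [commutatorElement_def]
    exact mul_mem (mul_mem (mul_mem hxH hyH) (inv_mem hxH)) (inv_mem hyH)
  have hc := commutatorElement_mem_commutator x y
  have hcB := h.commutatorElement_notMem hx hy
  have hBH : gammaThree G ≤ H := by
    intro t ht
    obtain ⟨u, rfl⟩ := h.exists_commutatorElement_eq hc hcB ht
    obtain ⟨i, j, a, ha, rfl⟩ := h.exists_eq_mul hx hy u
    have h1 := (h.commute_of_mem_commutator ha hc).commutator_eq
    have h2 : x ^ i * y ^ j ∈ H := mul_mem (zpow_mem hxH i) (zpow_mem hyH j)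
    rw [commutatorElement_mul_left_of_central (h.commutatorElement_mem_center hc a), h1, mul_one,
      commutatorElement_def]
    exact mul_mem (mul_mem (mul_mem h2 hcH) (inv_mem h2)) (inv_mem hcH)
  refine (Subgroup.eq_top_iff' H).mpr fun g => ?_
  obtain ⟨i, j, a, ha, rfl⟩ := h.exists_eq_mul hx hy g
  obtain ⟨k, t, ht, rfl⟩ := h.exists_eq_zpow_mul hc hcB ha
  exact mul_mem (mul_mem (zpow_mem hxH i) (zpow_mem hyH j)) (mul_mem (zpow_mem hcH k) (hBH ht))

theorem mem_zpowers_sup_of_commutatorElement_mem (h : IsClassThreeIndexSq p G) {y u : G}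
    (hy : y ∉ commutator G) (hu : ⁅y, u⁆ ∈ gammaThree G) :
    u ∈ Subgroup.zpowers y ⊔ commutator G :=
  by_contra fun hn => h.commutatorElement_notMem hy hn hu

/-- Write t = [u,c]: α scales u by λ modulo A and c by λ² modulo B, and these errors do not change
the commutator. -/
theorem apply_eq_pow_of_mem_gammaThree (h : IsClassThreeIndexSq p G) {α : MulAut G} {l : ℕ}
    (hl : ∀ x, α x * (x ^ l)⁻¹ ∈ commutator G) {t : G} (ht : t ∈ gammaThree G) :
    α t = t ^ (l * l * l) := by
  obtain ⟨c, hc, hcB⟩ := h.exists_notMem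
  obtain ⟨u, rfl⟩ := h.exists_commutatorElement_eq hc hcB ht
  have hcc := h.commutatorElement_mem_center hc
  have h1 := mk'_apply_eq_pow_of_mem_commutator hl hc
  rw [← map_pow, ← inv_mul_eq_one, ← map_inv, ← map_mul, mk'_eq_one_iff] at h1
  have e1 : α c = c ^ (l * l) * ((α c)⁻¹ * c ^ (l * l))⁻¹ := by group
  have e2 : α u = (α u * (u ^ l)⁻¹) * u ^ l := by group
  have hcl := h.commutatorElement_mem_center (pow_mem hc (l * l))
  have e3 : ∀ (n : ℕ) (v : G), ⁅v, c ^ n⁆ = ⁅v, c⁆ ^ n := fun n v => by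
    exact_mod_cast commutatorElement_zpow_right_of_mem_center (hcc v) n
  rw [map_commutatorElement, e1, commutatorElement_mul_center_right (h.le_center (inv_mem h1)), e2,
    commutatorElement_mul_left_of_central (hcl _),
    (h.commute_of_mem_commutator (hl u) (pow_mem hc _)).commutator_eq, one_mul,
    commutatorElement_pow_left_of_central hcl, e3, ← pow_mul]

/-- The scalar by which an intense automorphism acts on `G / ⁅G, G⁆` has square one. -/
theorem dvd_mul_self_sub_one (h : IsClassThreeIndexSq p G) {α : MulAut G} (hα : IsIntense α)
    {l : ℕ} (hl : ∀ x, α x * (x ^ l)⁻¹ ∈ commutator G) (hl0 : ¬ (p : ℤ) ∣ l) :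
    (p : ℤ) ∣ l * l - 1 := by
  by_contra hd
  have hd3 : ¬ (p : ℤ) ∣ l - l * l * l := by
    rw [← dvd_neg, show -((l : ℤ) - l * l * l) = l * (l * l - 1) by ring]
    exact fun hh => (prime_int_of_fact.dvd_or_dvd hh).elim hl0 hd
  -- On y^p ∈ B the automorphism acts both by λ³ and by an exponent m ≡ λ.
  have hpow : ∀ y : G, y ∉ commutator G → y ^ p = 1 := by
    intro y hy
    obtain ⟨g, m, e, hm⟩ := hα.exists_zpow_conj h.isPGroup hl hy
    have hs := h.pow_mem_gammaThree y
    have e1 : α (y ^ p) = (y ^ p) ^ m := by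
      have e2 : α (y ^ p) = g * (y ^ p) ^ m * g⁻¹ := by
        rw [map_pow, e, conj_pow, ← zpow_natCast, ← zpow_natCast, ← zpow_mul, ← zpow_mul, mul_comm]
      rw [e2, Subgroup.mem_center_iff.mp (h.le_center (zpow_mem hs m)), mul_inv_cancel_right]
    rw [h.apply_eq_pow_of_mem_gammaThree hl hs, ← zpow_natCast (y ^ p)] at e1
    refine Subgroup.mem_bot.mp (h.isPGroup.mem_of_zpow_mem (S := ⊥) (i := m - (l * l * l : ℕ))
      (fun hh => hd3 ?_) (Subgroup.mem_bot.mpr ?_))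
    · have := dvd_sub hh hm
      push_cast at this
      ring_nf at this ⊢
      exact this
    · rw [zpow_sub, ← e1, mul_inv_cancel]
  -- The conjugators for y and yt have a quotient h with [h,y^l] = t^(l - l³). This lies in B, so h
  -- ∈ ⟨y^l⟩A, and [h,y^l] is a power of [y,c].
  have hB : ∀ y : G, y ∉ commutator G → ∀ c ∈ commutator G, c ∉ gammaThree G →
      gammaThree G ≤ Subgroup.zpowers ⁅y, c⁆ := by
    intro y hy c hc hcB t ht
    have htz := h.le_center ht
    have hyt : y * t ∉ commutator G := fun hh =>
      hy ((Subgroup.mul_mem_cancel_right _ (gammaThree_le_commutator ht)).mp hh)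
    obtain ⟨g, m, e, hm⟩ := hα.exists_zpow_conj h.isPGroup hl hy
    obtain ⟨g', m', e', hm'⟩ := hα.exists_zpow_conj h.isPGroup hl hyt
    have red : ∀ (v : G) (m : ℤ), v ^ p = 1 → (p : ℤ) ∣ m - l → v ^ m = v ^ l := by
      intro v m hv hm
      have : v ^ (m - l) = 1 :=
        Subgroup.mem_bot.mp (zpow_mem_of_dvd (S := ⊥) (Subgroup.mem_bot.mpr hv) hm)
      rw [zpow_sub, mul_inv_eq_one, zpow_natCast] at this
      exact this
    rw [red _ _ (hpow y hy) hm] at e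
    have hcomm : Commute y t := Subgroup.mem_center_iff.mp htz y
    rw [red _ _ (hpow _ hyt) hm', map_mul, e, h.apply_eq_pow_of_mem_gammaThree hl ht,
      hcomm.mul_pow] at e'
    have hu : ⁅g'⁻¹ * g, y ^ l⁆ = t ^ ((l : ℤ) - l * l * l) := by
      have hz : ∀ (k : ℤ) (v : G), v * t ^ k = t ^ k * v := fun k v =>
        Subgroup.mem_center_iff.mp (zpow_mem htz k) v
      have e5 : g * y ^ l * g⁻¹ = t ^ ((l : ℤ) - l * l * l) * (g' * y ^ l * g'⁻¹) := by
        rw [← hz, zpow_sub, ← mul_assoc, eq_mul_inv_iff_mul_eq]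
        have := hz l g'⁻¹
        rw [zpow_natCast] at this
        rw [← mul_assoc g', mul_assoc _ (t ^ l), ← this] at e'
        rw [← mul_assoc] at e'
        exact_mod_cast e'
      have e6 : ⁅g'⁻¹ * g, y ^ l⁆ = g'⁻¹ * (g * y ^ l * g⁻¹) * g' * (y ^ l)⁻¹ := by
        rw [commutatorElement_def]; group
      rw [e6, e5, ← mul_assoc g'⁻¹, hz]
      group
    refine h.isPGroup.mem_of_zpow_mem hd3 ?_
    rw [← hu]
    have hyl : y ^ l ∉ commutator G := fun hh => hl0
      (dvd_of_zpow_mem h.isPGroup hy (by exact_mod_cast hh))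
    have huB : ⁅y ^ l, g'⁻¹ * g⁆ ∈ gammaThree G := by
      rw [← commutatorElement_inv, hu]
      exact inv_mem (zpow_mem ht _)
    obtain ⟨_, ⟨i, rfl⟩, a, ha, e7⟩ := Subgroup.mem_sup_of_normal_right.mp
      (h.mem_zpowers_sup_of_commutatorElement_mem hyl huB)
    obtain ⟨k, s, hs, rfl⟩ := h.exists_eq_zpow_mul hc hcB ha
    rw [← e7, ← mul_assoc, commutatorElement_mul_center_left (h.le_center hs)]
    have h8 : ⁅c ^ k, y ^ l⁆ ∈ Subgroup.zpowers ⁅y, c⁆ := by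
      rw [← commutatorElement_inv (y ^ l),
        commutatorElement_pow_left_of_central (h.commutatorElement_mem_center (zpow_mem hc k)),
        commutatorElement_zpow_right_of_mem_center (h.commutatorElement_mem_center hc y)]
      exact inv_mem (pow_mem (zpow_mem (Subgroup.mem_zpowers _) _) _)
    have h9 : ⁅c ^ k, y ^ l⁆ ∈ Subgroup.center G := by
      rw [← commutatorElement_inv]
      exact inv_mem (h.commutatorElement_mem_center (zpow_mem hc k) _)
    rw [commutatorElement_mul_left_of_central h9, ((Commute.refl (y ^ l)).zpow_left i).commutator_eq,
      one_mul]
    exact h8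
  obtain ⟨x, y, hx, hy⟩ := h.exists_pair
  obtain ⟨c, hc, hcB⟩ := h.exists_notMem
  have hcc := h.commutatorElement_mem_center hc
  -- B is generated by [x,c], so a power of x corrects y to an element outside A that centralises c;
  -- `hB` for that element gives B = 1.
  obtain ⟨k, hk⟩ := Subgroup.mem_zpowers_iff.mp
    (hB x hx c hc hcB (commutatorElement_mem_gammaThree_right hc y))
  have h1 : ⁅y * x ^ (-k), c⁆ = 1 := by
    rw [commutatorElement_mul_left_of_central (hcc _), commutatorElement_zpow_left_of_central hcc,
      ← hk, ← zpow_add, add_neg_cancel, zpow_zero]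
  have h2 : y * x ^ (-k) ∉ commutator G := fun hh => hy <| by
    have := mul_mem (Subgroup.mem_sup_right (S := Subgroup.zpowers x) hh)
      (Subgroup.mem_sup_left (T := commutator G) (zpow_mem (Subgroup.mem_zpowers x) k))
    simpa using this
  have h3 := hB _ h2 c hc hcB
  rw [h1, Subgroup.zpowers_one_eq_bot] at h3
  exact h.ne_bot (le_bot_iff.mp h3)

end IsClassThreeIndexSq

/-- The graph of inversion on a central subgroup `B`. -/
def invGraph {G : Type*} [Group G] (B : Subgroup G) (hB : B ≤ Subgroup.center G) :
    Subgroup (G × G) where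
  carrier := {w | w.1 ∈ B ∧ w.2 = w.1⁻¹}
  one_mem' := ⟨one_mem B, by simp⟩
  mul_mem' := by
    rintro a b ⟨ha, ha'⟩ ⟨hb, hb'⟩
    refine ⟨mul_mem ha hb, ?_⟩
    rw [Prod.snd_mul, Prod.fst_mul, ha', hb', mul_inv_rev,
      Subgroup.mem_center_iff.mp (inv_mem (hB hb))]
  inv_mem' := by
    rintro a ⟨ha, ha'⟩
    exact ⟨inv_mem ha, by simp [ha']⟩

theorem mem_invGraph {G : Type*} [Group G] {B : Subgroup G} {hB : B ≤ Subgroup.center G}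
    {w : G × G} : w ∈ invGraph B hB ↔ w.1 ∈ B ∧ w.2 = w.1⁻¹ := Iff.rfl

theorem invGraph_normal {G : Type*} [Group G] (B : Subgroup G) (hB : B ≤ Subgroup.center G) :
    (invGraph B hB).Normal := by
  refine Subgroup.normal_of_le_center fun w hw => Subgroup.mem_center_iff.mpr fun g => ?_
  obtain ⟨h1, h2⟩ := mem_invGraph.mp hw
  refine Prod.ext (Subgroup.mem_center_iff.mp (hB h1) g.1) ?_
  rw [Prod.snd_mul, Prod.snd_mul, h2]
  exact Subgroup.mem_center_iff.mp (inv_mem (hB h1)) g.2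

/-! ### An involution inverting the abelianization -/

namespace IsClassThreeIndexSq

variable {p : ℕ} [Fact p.Prime] {G : Type*} [Group G]

/-- Let K be the graph of inversion on B. Modulo K, w has the normal form X^i Y^j [X,Y]^k; first
coordinate 1 makes p divide i, j, k, and X^p, Y^p, [X,Y]^p lie in K. So w ∈ K, whose elements are
determined by their first coordinate. -/
theorem snd_eq_one_of_mem_closure (h : IsClassThreeIndexSq p G) {x y : G}
    (hx : x ∉ commutator G) (hy : y ∉ Subgroup.zpowers x ⊔ commutator G) {w : G × G}
    (hw : w ∈ Subgroup.closure {(x, x⁻¹), (y, y⁻¹)}) (hw1 : w.1 = 1) : w.2 = 1 := by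
  have hK := invGraph_normal (gammaThree G) h.le_center
  set K := invGraph (gammaThree G) h.le_center
  set X : G × G := (x, x⁻¹) with hX
  set Y : G × G := (y, y⁻¹) with hY
  have hc := commutatorElement_mem_commutator x y
  have hcc := h.commutatorElement_mem_center hc
  -- Modulo B the two signs cancel; a third inverted entry then inverts the triple commutators,
  -- which is what puts them in K.
  have hc' : ⁅x, y⁆⁻¹ * ⁅x⁻¹, y⁻¹⁆ ∈ gammaThree G := by
    have hq := commutatorElement_quotient_mem_center (G := G) (N := gammaThree G) le_rfl
    have e1 := commutatorElement_zpow_left_of_central (fun b => hq b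
      (QuotientGroup.mk' (gammaThree G) y⁻¹)) (QuotientGroup.mk' (gammaThree G) x) (-1)
    have e2 := commutatorElement_zpow_right_of_central (fun b => hq
      (QuotientGroup.mk' (gammaThree G) x) b) (QuotientGroup.mk' (gammaThree G) y) (-1)
    rw [zpow_neg_one, zpow_neg_one] at e1 e2
    rw [← mk'_eq_one_iff, map_mul, map_inv, map_commutatorElement, map_commutatorElement,
      map_inv _ x, e1, map_inv, e2, inv_inv, inv_mul_cancel]
  have hcomm : ∀ v : G, ⁅v⁻¹, ⁅x⁻¹, y⁻¹⁆⁆ = ⁅v, ⁅x, y⁆⁆⁻¹ := by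
    intro v
    rw [← mul_inv_cancel_left ⁅x, y⁆ ⁅x⁻¹, y⁻¹⁆,
      commutatorElement_mul_center_right (h.le_center hc'), ← zpow_neg_one v,
      commutatorElement_zpow_left_of_central hcc, zpow_neg_one]
  have hXK : ⁅X, ⁅X, Y⁆⁆ ∈ K :=
    mem_invGraph.mpr ⟨commutatorElement_mem_gammaThree_right hc x, hcomm x⟩
  have hYK : ⁅Y, ⁅X, Y⁆⁆ ∈ K :=
    mem_invGraph.mpr ⟨commutatorElement_mem_gammaThree_right hc y, hcomm y⟩
  obtain ⟨i, j, k, t, ht, rfl⟩ := exists_zpow_of_mem_closure_pair_sup hXK hYK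
    (Subgroup.mem_sup_left (T := K) hw)
  have e : x ^ i * y ^ j * ⁅x, y⁆ ^ k * t.1 = 1 := hw1
  have htB := (mem_invGraph.mp ht).1
  obtain ⟨hi, hj⟩ := indep_of_notMem h.isPGroup h.pow_mem_commutator hx hy i j (by
    have e' : x ^ i * y ^ j = (⁅x, y⁆ ^ k * t.1)⁻¹ := by
      rw [mul_assoc] at e; exact eq_inv_of_mul_eq_one_left e
    rw [e']
    exact inv_mem (mul_mem (zpow_mem hc k) (gammaThree_le_commutator htB)))
  have hk : (p : ℤ) ∣ k := by
    refine dvd_of_zpow_mem h.isPGroup (h.commutatorElement_notMem hx hy) (i := k) ?_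
    have e' : ⁅x, y⁆ ^ k = (x ^ i * y ^ j)⁻¹ * t.1⁻¹ := by
      rw [mul_assoc, ← eq_inv_mul_iff_mul_eq, mul_one] at e
      exact eq_mul_inv_of_mul_eq e
    rw [e']
    exact mul_mem (inv_mem (mul_mem (zpow_mem_of_dvd (h.pow_mem_gammaThree x) hi)
      (zpow_mem_of_dvd (h.pow_mem_gammaThree y) hj))) (inv_mem htB)
  have hpow : ∀ v : G, (v, v⁻¹) ^ p ∈ K := fun v =>
    mem_invGraph.mpr ⟨h.pow_mem_gammaThree v, inv_pow v p⟩
  have hD : ⁅X, Y⁆ ^ p ∈ K := by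
    have h1 : ⁅X, Y⁆ ^ p = 1 := Prod.ext (h.pow_eq_one_of_mem_commutator hc)
      (h.pow_eq_one_of_mem_commutator (commutatorElement_mem_commutator _ _))
    rw [h1]; exact one_mem K
  have hfin : X ^ i * Y ^ j * ⁅X, Y⁆ ^ k * t ∈ K := mul_mem (mul_mem (mul_mem
    (zpow_mem_of_dvd (hpow x) hi) (zpow_mem_of_dvd (hpow y) hj)) (zpow_mem_of_dvd hD hk)) ht
  rw [(mem_invGraph.mp hfin).2, hw1, inv_one]

theorem hom_ext (h : IsClassThreeIndexSq p G) {x y : G} (hx : x ∉ commutator G)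
    (hy : y ∉ Subgroup.zpowers x ⊔ commutator G) {M : Type*} [Group M] {f g : G →* M}
    (hfx : f x = g x) (hfy : f y = g y) : f = g := by
  have : f.eqLocus g = ⊤ := h.eq_top_of_mem hx hy hfx hfy
  exact MonoidHom.ext fun v => (Subgroup.eq_top_iff' _).mp this v

/-- A `p`-group of class three with `p` odd and commutator subgroup of index `p ^ 2` has an
automorphism of order two that inverts the abelianization. -/
theorem exists_involution (h : IsClassThreeIndexSq p G) :
    ∃ α : MulAut G, (∀ g, α (α g) = g) ∧ ∀ g, α g * g ∈ commutator G := by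
  obtain ⟨x, y, hx, hy⟩ := h.exists_pair
  set Γ : Subgroup (G × G) := Subgroup.closure {(x, x⁻¹), (y, y⁻¹)} with hΓ
  have hxΓ : (x, x⁻¹) ∈ Γ := Subgroup.subset_closure (by simp)
  have hyΓ : (y, y⁻¹) ∈ Γ := Subgroup.subset_closure (by simp)
  let f : Γ →* G := (MonoidHom.fst G G).comp Γ.subtype
  have hinj : Function.Injective f := by
    rw [injective_iff_map_eq_one]
    intro w hw
    exact Subtype.ext (Prod.ext hw (h.snd_eq_one_of_mem_closure hx hy w.2 hw))
  have hsurj : Function.Surjective f := by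
    rw [← MonoidHom.range_eq_top]
    exact h.eq_top_of_mem hx hy ⟨⟨_, hxΓ⟩, rfl⟩ ⟨⟨_, hyΓ⟩, rfl⟩
  let e : Γ ≃* G := MulEquiv.ofBijective f ⟨hinj, hsurj⟩
  let a : G →* G := ((MonoidHom.snd G G).comp Γ.subtype).comp e.symm.toMonoidHom
  have hae : ∀ w : Γ, a w.1.1 = w.1.2 := by
    intro w
    have : e.symm (w.1.1) = w := e.symm_apply_apply w
    change ((e.symm w.1.1 : Γ) : G × G).2 = _
    rw [this]
  have hax : a x = x⁻¹ := hae ⟨_, hxΓ⟩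
  have hay : a y = y⁻¹ := hae ⟨_, hyΓ⟩
  have haa : a.comp a = MonoidHom.id G := by
    exact h.hom_ext hx hy
      (show a (a x) = x by rw [hax, map_inv, hax, inv_inv])
      (show a (a y) = y by rw [hay, map_inv, hay, inv_inv])
  refine ⟨MonoidHom.toMulEquiv a a haa haa, fun g => DFunLike.congr_fun haa g, fun g => ?_⟩
  have hab : (Abelianization.of.comp a) = invMonoidHom.comp (Abelianization.of (G := G)) := by
    exact h.hom_ext hx hy
      (show Abelianization.of (a x) = (Abelianization.of x)⁻¹ by rw [hax, map_inv])
      (show Abelianization.of (a y) = (Abelianization.of y)⁻¹ by rw [hay, map_inv])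
  have hg : Abelianization.of (a g) = (Abelianization.of g)⁻¹ := DFunLike.congr_fun hab g
  change a g * g ∈ _
  rw [← Abelianization.ker_of, MonoidHom.mem_ker, map_mul, hg, inv_mul_cancel]

end IsClassThreeIndexSq

theorem mem_map_conj {G : Type*} [Group G] {H : Subgroup G} {g v : G} :
    v ∈ H.map (MulAut.conj g).toMonoidHom ↔ g⁻¹ * v * g ∈ H := by
  constructor
  · rintro ⟨w, hw, rfl⟩
    change g⁻¹ * (g * w * g⁻¹) * g ∈ H
    simpa [mul_assoc] using hw
  · intro h
    refine ⟨_, h, ?_⟩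
    change g * (g⁻¹ * v * g) * g⁻¹ = v
    group

theorem conj_mem_map_conj {G : Type*} [Group G] {H : Subgroup G} {g v : G} (h : v ∈ H) :
    g * v * g⁻¹ ∈ H.map (MulAut.conj g).toMonoidHom :=
  mem_map_conj.mpr (by simpa [mul_assoc] using h)

theorem map_conj_map_conj {G : Type*} [Group G] (H : Subgroup G) (g k : G) :
    (H.map (MulAut.conj k).toMonoidHom).map (MulAut.conj g).toMonoidHom
      = H.map (MulAut.conj (g * k)).toMonoidHom := by
  ext v
  rw [mem_map_conj, mem_map_conj, mem_map_conj]
  simp [mul_assoc]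

/-- An involution is intense if each subgroup has a stable conjugate. -/
theorem isIntense_of_exists_stable_conj {G : Type*} [Group G] {α : MulAut G}
    (hα : ∀ g, α (α g) = g)
    (h : ∀ H : Subgroup G, ∃ g, ∀ v ∈ H.map (MulAut.conj g).toMonoidHom,
      α v ∈ H.map (MulAut.conj g).toMonoidHom) : IsIntense α := by
  intro H
  obtain ⟨g, hg⟩ := h H
  have hg' : ∀ v ∈ H, g⁻¹ * (α g * α v * α g⁻¹) * g ∈ H := by
    intro v hv
    have := mem_map_conj.mp (hg _ (conj_mem_map_conj hv))
    rwa [map_mul, map_mul] at this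
  -- Stability of gHg⁻¹ reads α(g)α(H)α(g)⁻¹ = gHg⁻¹, with equality because α is an involution.
  refine ⟨α g⁻¹ * g, ?_⟩
  ext v
  rw [mem_map_conj]
  constructor
  · rintro ⟨w, hw, rfl⟩
    have := hg' w hw
    rw [map_inv] at this ⊢
    convert this using 1
    change (_ * α w) * _ = _
    group
  · intro hv
    refine ⟨α v, ?_, hα v⟩
    change α v ∈ H
    have := hg' _ hv
    simp only [map_mul, map_inv, hα] at this
    convert this using 1
    group

/-! ### The involution is intense -/

namespace IsClassThreeIndexSq

variable {p : ℕ} [Fact p.Prime] {G : Type*} [Group G]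

theorem not_dvd_two (h : IsClassThreeIndexSq p G) : ¬ (p : ℤ) ∣ 2 := by
  intro hd
  have hp : p.Prime := Fact.out
  have : p = 2 := (Nat.prime_dvd_prime_iff_eq hp Nat.prime_two).mp (by exact_mod_cast hd)
  have ho := h.odd
  rw [this] at ho
  exact absurd ho (by decide)

/-- The scalar -1 is represented by the natural exponent p - 1, the form the earlier lemmas need. -/
theorem apply_mul_pow_inv_mem (h : IsClassThreeIndexSq p G) {α : MulAut G}
    (hα : ∀ g, α g * g ∈ commutator G) (x : G) : α x * (x ^ (p - 1))⁻¹ ∈ commutator G := by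
  have h1 := mul_mem (hα x) (inv_mem (h.pow_mem_commutator x))
  have hp : p = p - 1 + 1 := (Nat.succ_pred_prime Fact.out).symm
  rw [hp, pow_succ', mul_inv_rev] at h1
  convert h1 using 1
  have : Commute (x ^ (p - 1))⁻¹ x⁻¹ := ((Commute.refl x).pow_left _).inv_inv
  rw [this.eq]
  group

theorem involution_apply_of_mem_gammaThree (h : IsClassThreeIndexSq p G) {α : MulAut G}
    (hα : ∀ g, α g * g ∈ commutator G) {t : G} (ht : t ∈ gammaThree G) : α t = t⁻¹ := by
  rw [h.apply_eq_pow_of_mem_gammaThree (h.apply_mul_pow_inv_mem hα) ht, eq_inv_iff_mul_eq_one,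
    ← pow_succ]
  have hp1 : 1 ≤ p := (Fact.out : p.Prime).one_le
  have hd : (p : ℤ) ∣ ((p - 1) * (p - 1) * (p - 1) + 1 : ℕ) := by
    push_cast [Nat.cast_sub hp1]
    exact ⟨(p : ℤ) ^ 2 - 3 * p + 3, by ring⟩
  obtain ⟨m, hm⟩ := Int.natCast_dvd_natCast.mp hd
  rw [hm, pow_mul, h.pow_eq_one_of_mem_gammaThree ht, one_pow]

/-- For c ∈ A \ B the element c α(c) is fixed since A is abelian. As α acts on A/B by (-1)² = 1, it
is c² modulo B, so not in B for odd p. -/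
theorem exists_fixed (h : IsClassThreeIndexSq p G) {α : MulAut G} (hαα : ∀ g, α (α g) = g)
    (hα : ∀ g, α g * g ∈ commutator G) :
    ∃ c ∈ commutator G, c ∉ gammaThree G ∧ α c = c := by
  obtain ⟨c, hc, hcB⟩ := h.exists_notMem
  have hαc : α c ∈ commutator G := ((commutator G).mul_mem_cancel_right hc).mp (hα c)
  refine ⟨c * α c, mul_mem hc hαc, fun hmem => ?_, ?_⟩
  · have e := mk'_apply_eq_pow_of_mem_commutator (h.apply_mul_pow_inv_mem hα) hc
    rw [← mk'_eq_one_iff, map_mul, e, ← pow_succ', ← map_pow, mk'_eq_one_iff,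
      ← zpow_natCast] at hmem
    have hd := dvd_of_zpow_mem h.isPGroup hcB hmem
    have hp1 : 1 ≤ p := (Fact.out : p.Prime).one_le
    push_cast [Nat.cast_sub hp1] at hd
    refine h.not_dvd_two ((dvd_sub_right (⟨(p : ℤ) - 2, rfl⟩ :
      (p : ℤ) ∣ p * (p - 2))).mp ?_)
    have h3 := dvd_sub (dvd_mul_right (p : ℤ) (2 * (p - 2))) hd
    ring_nf at h3 ⊢
    exact h3
  · rw [map_mul, hαα, (h.commute_of_mem_commutator hc hαc).eq]

/-- The element s = α(v)v of B is inverted by α, while α(s) = vα(v) is conjugate to the central s.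
So s² = 1 and s = 1. -/
theorem involution_apply_eq_inv (h : IsClassThreeIndexSq p G) {α : MulAut G}
    (hαα : ∀ g, α (α g) = g) (hα : ∀ g, α g * g ∈ commutator G) {v : G}
    (hv : α v * v ∈ gammaThree G) : α v = v⁻¹ := by
  have h1 := h.involution_apply_of_mem_gammaThree hα hv
  rw [map_mul, hαα] at h1
  have h2 : v * α v = α v * v := by
    have := Subgroup.mem_center_iff.mp (h.le_center hv) v
    calc v * α v = v * (α v * v) * v⁻¹ := by group
      _ = _ := by rw [this]; group
  rw [h2] at h1
  refine eq_inv_of_mul_eq_one_left (Subgroup.mem_bot.mp (h.isPGroup.mem_of_zpow_mem h.not_dvd_two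
    (S := ⊥) (Subgroup.mem_bot.mpr ?_)))
  rw [zpow_two]
  nth_rewrite 1 [h1]
  exact inv_mul_cancel _

/-- Let α(v)v ≡ c^k modulo B and p = 2m + 1. As [v,y] generates A/B, some conjugate of v is c^(km) v
modulo B, and its product with its image is c^(2km+k) = c^(pk) = 1 there. -/
theorem exists_conj_involution_apply_eq_inv (h : IsClassThreeIndexSq p G) {α : MulAut G}
    (hαα : ∀ g, α (α g) = g) (hα : ∀ g, α g * g ∈ commutator G) {v : G} (hv : v ∉ commutator G) :
    ∃ g, α (g * v * g⁻¹) = (g * v * g⁻¹)⁻¹ := by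
  obtain ⟨c, hc, hcB, hαc⟩ := h.exists_fixed hαα hα
  obtain ⟨k, t, ht, e⟩ := h.exists_eq_zpow_mul hc hcB (hα v)
  obtain ⟨m, hm⟩ := h.odd
  obtain ⟨y, hy⟩ : ∃ y, y ∉ Subgroup.zpowers v ⊔ commutator G := by
    by_contra! hn
    exact zpowers_sup_commutator_ne_top h.le_center h.ne_bot v ((Subgroup.eq_top_iff' _).mpr hn)
  obtain ⟨i, s, hs, e2⟩ := h.exists_eq_zpow_mul (commutatorElement_mem_commutator v y)
    (h.commutatorElement_notMem hv hy) (zpow_mem hc (k * m))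
  refine ⟨y ^ (-i), h.involution_apply_eq_inv hαα hα ?_⟩
  have hq := commutatorElement_quotient_mem_center (G := G) (N := gammaThree G) le_rfl
  have e3 : ⁅y ^ (-i), v⁆ * (c ^ (k * m))⁻¹ ∈ gammaThree G := by
    rw [← mk'_eq_one_iff] at hs
    rw [← mk'_eq_one_iff, e2, map_mul, map_inv, map_mul, hs, mul_one, map_zpow,
      map_commutatorElement, map_zpow, commutatorElement_zpow_left_of_central (fun b => hq b _),
      map_commutatorElement, ← commutatorElement_inv (QuotientGroup.mk' _ v), inv_zpow, zpow_neg,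
      inv_inv, mul_inv_cancel]
  set b := ⁅y ^ (-i), v⁆ * (c ^ (k * m))⁻¹ with hb
  have e4 : y ^ (-i) * v * (y ^ (-i))⁻¹ = b * c ^ (k * m) * v := by
    rw [hb, commutatorElement_def]; group
  have hcZ := mk'_mem_center (N := gammaThree G) le_rfl hc
  have hc1 : ∀ (n : ℤ) (g : G ⧸ gammaThree G), Commute g (QuotientGroup.mk' (gammaThree G) c ^ n) :=
    fun n g => Subgroup.mem_center_iff.mp (zpow_mem hcZ n) g
  have hcp : c ^ (p : ℤ) = 1 := by
    rw [zpow_natCast]; exact h.pow_eq_one_of_mem_commutator hc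
  rw [e4, map_mul, map_mul, map_zpow, hαc, h.involution_apply_of_mem_gammaThree hα e3]
  have ht1 := mk'_eq_one_iff.mpr ht
  have hb1 := mk'_eq_one_iff.mpr e3
  have e' := congrArg (QuotientGroup.mk' (gammaThree G)) e
  rw [map_mul, map_mul, ht1, mul_one, map_zpow] at e'
  rw [← mk'_eq_one_iff]
  simp only [map_mul, map_inv, map_zpow]
  rw [hb1, inv_one, one_mul, mul_assoc,
    ← mul_assoc (QuotientGroup.mk' _ (α v)), (hc1 _ _).eq, mul_assoc, e', ← mul_assoc, ← zpow_add, ← zpow_add, ← map_zpow,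
    show k * m + k * m + k = p * k by rw [hm]; push_cast; ring, zpow_mul, hcp, one_zpow, map_one]

section Stable

variable {α : MulAut G} {c : G} {H : Subgroup G}

theorem involution_apply_mem (h : IsClassThreeIndexSq p G)
    (hα : ∀ g, α g * g ∈ commutator G) (hc : c ∈ commutator G) (hcB : c ∉ gammaThree G)
    (hαc : α c = c) {v : G} (hvH : v ∈ H) (hv : v ∈ commutator G)
    (hcv : c ∈ H ∨ v ∈ gammaThree G) : α v ∈ H := by
  rcases hcv with hcH | hvB
  · obtain ⟨k, t, ht, rfl⟩ := h.exists_eq_zpow_mul hc hcB hv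
    have hck := zpow_mem hcH k
    rw [map_mul, map_zpow, hαc, h.involution_apply_of_mem_gammaThree hα ht]
    exact mul_mem hck (inv_mem ((H.mul_mem_cancel_left hck).mp hvH))
  · rw [h.involution_apply_of_mem_gammaThree hα hvB]
    exact inv_mem hvH

theorem involution_apply_mem_of_le_sup (h : IsClassThreeIndexSq p G)
    (hα : ∀ g, α g * g ∈ commutator G) (hc : c ∈ commutator G) (hcB : c ∉ gammaThree G)
    (hαc : α c = c) {u : G} (huH : u ∈ H) (hu : α u = u⁻¹)
    (hle : H ≤ Subgroup.zpowers u ⊔ commutator G)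
    (hcH : c ∈ H ∨ ∀ v ∈ H, v ∈ commutator G → v ∈ gammaThree G) {v : G} (hv : v ∈ H) :
    α v ∈ H := by
  obtain ⟨_, ⟨i, rfl⟩, a, ha, rfl⟩ := Subgroup.mem_sup_of_normal_right.mp (hle hv)
  have hui : u ^ i ∈ H := zpow_mem huH i
  have haH : a ∈ H := (H.mul_mem_cancel_left hui).mp hv
  change α (u ^ i * a) ∈ H
  rw [map_mul, map_zpow, hu]
  exact mul_mem (zpow_mem (inv_mem huH) i)
    (h.involution_apply_mem hα hc hcB hαc haH ha (hcH.imp_right fun hh => hh a haH ha))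

theorem exists_mul_mem (h : IsClassThreeIndexSq p G) (hc : c ∈ commutator G) {v : G}
    (hvH : v ∈ H) (hv : v ∈ commutator G) (hvB : v ∉ gammaThree G) :
    ∃ s ∈ gammaThree G, c * s ∈ H := by
  obtain ⟨i, s, hs, e⟩ := h.exists_eq_zpow_mul hv hvB hc
  refine ⟨s⁻¹, inv_mem hs, ?_⟩
  rw [e, mul_inv_cancel_right]
  exact zpow_mem hvH i

end Stable

theorem exists_stable_conj (h : IsClassThreeIndexSq p G) {α : MulAut G}
    (hαα : ∀ g, α (α g) = g) (hα : ∀ g, α g * g ∈ commutator G) (H : Subgroup G) :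
    ∃ g, ∀ v ∈ H.map (MulAut.conj g).toMonoidHom, α v ∈ H.map (MulAut.conj g).toMonoidHom := by
  obtain ⟨c, hc, hcB, hαc⟩ := h.exists_fixed hαα hα
  by_cases hHB : H ≤ gammaThree G
  · refine ⟨1, fun v hv => ?_⟩
    rw [mem_map_conj] at hv ⊢
    have hv' : v ∈ H := by simpa using hv
    rw [h.involution_apply_of_mem_gammaThree hα (hHB hv')]
    simpa using hv'
  by_cases hHA : H ≤ commutator G
  · obtain ⟨v, hvH, hvB⟩ := Set.not_subset.mp hHB
    obtain ⟨s, hs, hcs⟩ := h.exists_mul_mem hc hvH (hHA hvH) hvB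
    -- Conjugation by g multiplies c by s⁻¹, so it carries cs to c.
    obtain ⟨g, hg⟩ := h.exists_commutatorElement_eq hc hcB (inv_mem hs)
    have hcH : c ∈ H.map (MulAut.conj g).toMonoidHom := by
      have : g * (c * s) * g⁻¹ = c := by
        have hz := Subgroup.mem_center_iff.mp (h.le_center hs)
        calc g * (c * s) * g⁻¹ = ⁅g, c⁆ * (g * c * g⁻¹ * c⁻¹)⁻¹ * (g * (c * s) * g⁻¹) := by
              rw [commutatorElement_def]; group
          _ = s⁻¹ * (c * (g * s * g⁻¹)) := by rw [hg]; group
          _ = c := by rw [hz g, mul_inv_cancel_right, hz c, inv_mul_cancel_left]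
      rw [← this]
      exact conj_mem_map_conj hcs
    refine ⟨g, fun v hv => h.involution_apply_mem hα hc hcB hαc hv ?_ (Or.inl hcH)⟩
    have := Subgroup.Normal.conj_mem inferInstance _ (hHA (mem_map_conj.mp hv)) g
    simpa [mul_assoc] using this
  obtain ⟨v, hvH, hvA⟩ := Set.not_subset.mp hHA
  obtain ⟨g, hg⟩ := h.exists_conj_involution_apply_eq_inv hαα hα hvA
  set u := g * v * g⁻¹ with hu
  have huA : u ∉ commutator G := fun hh => hvA (by
    simpa [hu, mul_assoc] using Subgroup.Normal.conj_mem inferInstance _ hh g⁻¹)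
  set H₁ := H.map (MulAut.conj g).toMonoidHom with hH₁
  have huH : u ∈ H₁ := conj_mem_map_conj hvH
  by_cases hle : H₁ ≤ Subgroup.zpowers u ⊔ commutator G
  swap
  · obtain ⟨y, hyH, hy⟩ := Set.not_subset.mp hle
    have : H₁ = ⊤ := h.eq_top_of_mem huA hy huH hyH
    exact ⟨g, fun v _ => by rw [← hH₁, this]; exact Subgroup.mem_top _⟩
  by_cases hB : ∀ v ∈ H₁, v ∈ commutator G → v ∈ gammaThree G
  · exact ⟨g, fun v hv =>
      h.involution_apply_mem_of_le_sup hα hc hcB hαc huH hg hle (Or.inr hB) hv⟩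
  push Not at hB
  obtain ⟨w, hwH, hwA, hwB⟩ := hB
  obtain ⟨s, hs, hcs⟩ := h.exists_mul_mem hc hwH hwA hwB
  obtain ⟨y, hy⟩ : ∃ y, y ∉ Subgroup.zpowers u ⊔ commutator G := by
    by_contra! hn
    exact zpowers_sup_commutator_ne_top h.le_center h.ne_bot u ((Subgroup.eq_top_iff' _).mpr hn)
  have hcc := h.commutatorElement_mem_center hc
  -- Only the factor y^j of r matters: [u^i,c] = [u^i,cs] is already in H₁, so c[y^j,c] is too.
  obtain ⟨r, hr⟩ := h.exists_commutatorElement_eq hc hcB hs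
  obtain ⟨i, j, a, ha, rfl⟩ := h.exists_eq_mul huA hy r
  rw [commutatorElement_mul_left_of_central (hcc _), (h.commute_of_mem_commutator ha hc).commutator_eq,
    mul_one, commutatorElement_mul_left_of_central (hcc _)] at hr
  have hui : ⁅u ^ i, c⁆ ∈ H₁ := by
    rw [← commutatorElement_mul_center_right (h.le_center hs), commutatorElement_def]
    have := zpow_mem huH i
    exact mul_mem (mul_mem (mul_mem this hcs) (inv_mem this)) (inv_mem hcs)
  have hyc : y ^ j * c * (y ^ j)⁻¹ ∈ H₁ := by
    have h1 := mul_mem hcs (inv_mem hui)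
    have hz := Subgroup.mem_center_iff.mp (hcc (y ^ j)) c
    have hz' := Subgroup.mem_center_iff.mp (hcc (y ^ j)) ⁅u ^ i, c⁆
    rw [← hr, hz', ← mul_assoc, mul_inv_cancel_right, hz] at h1
    rw [commutatorElement_def] at h1
    simpa using h1
  set k := (y ^ j)⁻¹ with hk
  set H₂ := H₁.map (MulAut.conj k).toMonoidHom with hH₂
  have hcH₂ : c ∈ H₂ := mem_map_conj.mpr (by rw [hk, inv_inv]; exact hyc)
  have huH₂ : k * u * k⁻¹ ∈ H₂ := conj_mem_map_conj huH
  have hka : u⁻¹ * (k * u * k⁻¹) ∈ commutator G := by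
    have := commutatorElement_mem_commutator u⁻¹ k
    rw [commutatorElement_def] at this
    simpa [mul_assoc] using this
  -- Conjugating by k changes u by a factor c^n b. Since c ∈ H₂, the power of c can be removed, and
  -- α still inverts ub.
  obtain ⟨n, b, hb, e⟩ := h.exists_eq_zpow_mul hc hcB hka
  have hbz := Subgroup.mem_center_iff.mp (h.le_center hb)
  have hub : u * b ∈ H₂ := by
    have e2 : k * u * k⁻¹ = u * b * c ^ n := by
      rw [inv_mul_eq_iff_eq_mul.mp e, hbz (c ^ n), ← mul_assoc]
    rw [e2] at huH₂
    exact (H₂.mul_mem_cancel_right (zpow_mem hcH₂ n)).mp huH₂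
  have hle₂ : H₂ ≤ Subgroup.zpowers (u * b) ⊔ commutator G := by
    have hsup : Subgroup.zpowers u ⊔ commutator G ≤ Subgroup.zpowers (u * b) ⊔ commutator G := by
      refine sup_le (Subgroup.zpowers_le.mpr ?_) le_sup_right
      exact (Subgroup.mul_mem_cancel_right _ (Subgroup.mem_sup_right
        (gammaThree_le_commutator hb))).mp (Subgroup.mem_sup_left (Subgroup.mem_zpowers _))
    refine le_trans (fun v hv => ?_) hsup
    have hn : (Subgroup.zpowers u ⊔ commutator G).Normal :=
      Subgroup.Normal.of_commutator_le _ le_sup_right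
    have := hn.conj_mem _ (hle (mem_map_conj.mp hv)) k
    simpa [mul_assoc] using this
  have hαub : α (u * b) = (u * b)⁻¹ := by
    rw [map_mul, hg, h.involution_apply_of_mem_gammaThree hα hb, hbz u]
    exact (mul_inv_rev b u).symm
  refine ⟨k * g, ?_⟩
  rw [← map_conj_map_conj]
  exact fun v hv =>
    h.involution_apply_mem_of_le_sup hα hc hcB hαc hub hαub hle₂ (Or.inl hcH₂) hv

theorem isIntense_involution (h : IsClassThreeIndexSq p G) {α : MulAut G}
    (hαα : ∀ g, α (α g) = g) (hα : ∀ g, α g * g ∈ commutator G) : IsIntense α :=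
  isIntense_of_exists_stable_conj hαα (h.exists_stable_conj hαα hα)

end IsClassThreeIndexSq

/-! ### Computing the intensity -/

section

variable {p : ℕ} [Fact p.Prime] {G : Type*} [Group G]

/-- The scalar in `𝔽_pˣ` by which an intense automorphism acts on `G / Φ(G)`. -/
noncomputable def frattiniScalarHom (p : ℕ) [Fact p.Prime] (G : Type*) [Group G] :
    intenseAut G →* (ZMod p)ˣ :=
  (intenseScalarHom p (quotient_pFrattini_comm p G) (quotient_pFrattini_pow p G)).comp
    (intenseAutQuotient (pFrattini p G))

theorem teichmullerChar_injective : Function.Injective (teichmullerChar p) := fun a b h =>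
  Units.ext (by rw [← toZMod_teichmullerChar, h, toZMod_teichmullerChar])

theorem intensity_eq_card_range : intensity p G = Nat.card (frattiniScalarHom p G).range := by
  rw [← Subgroup.index_ker]
  unfold intensity
  congr 1
  ext α
  rw [MonoidHom.mem_ker, MonoidHom.mem_ker]
  exact map_eq_one_iff _ teichmullerChar_injective

theorem apply_mul_inv_mem_pFrattini (α : intenseAut G) (x : G) :
    (α : MulAut G) x * (x ^ (frattiniScalarHom p G α : ZMod p).val)⁻¹ ∈ pFrattini p G := by
  have h := intenseScalar_spec p (quotient_pFrattini_comm p G) (quotient_pFrattini_pow p G)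
    (intenseAutQuotient (pFrattini p G) α) (x : G ⧸ pFrattini p G)
  have h' : QuotientGroup.mk' (pFrattini p G) ((α : MulAut G) x) =
      QuotientGroup.mk' (pFrattini p G) x ^ (frattiniScalarHom p G α : ZMod p).val := h
  rw [← mk'_eq_one_iff, map_mul, map_inv, h', map_pow, mul_inv_cancel]

theorem not_dvd_val (m : (ZMod p)ˣ) : ¬ (p : ℤ) ∣ ((m : ZMod p).val : ℤ) := by
  intro h
  rw [← ZMod.intCast_zmod_eq_zero_iff_dvd] at h
  simp at h

theorem dvd_val_sub_iff (m : (ZMod p)ˣ) (k : ℤ) :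
    (p : ℤ) ∣ ((m : ZMod p).val : ℤ) - k ↔ (m : ZMod p) = k := by
  rw [← ZMod.intCast_zmod_eq_zero_iff_dvd, Int.cast_sub, sub_eq_zero]
  simp

theorem IsClassThreeIndexSq.frattiniScalarHom_eq (h : IsClassThreeIndexSq p G)
    (α : intenseAut G) : frattiniScalarHom p G α = 1 ∨ frattiniScalarHom p G α = -1 := by
  have hl := apply_mul_inv_mem_pFrattini (p := p) α
  rw [pFrattini_eq_commutator h.pow_mem_commutator] at hl
  have h1 := h.dvd_mul_self_sub_one α.2 hl (not_dvd_val _)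
  rw [← ZMod.intCast_zmod_eq_zero_iff_dvd] at h1
  push_cast at h1
  rw [ZMod.natCast_zmod_val, sub_eq_zero, mul_self_eq_one_iff] at h1
  exact h1.imp (fun e => Units.ext e) (fun e => Units.ext e)

theorem IsClassThreeIndexSq.exists_frattiniScalarHom_eq_neg_one (h : IsClassThreeIndexSq p G) :
    ∃ α : intenseAut G, frattiniScalarHom p G α = -1 := by
  obtain ⟨α, hαα, hα⟩ := h.exists_involution
  refine ⟨⟨α, h.isIntense_involution hαα hα⟩, ?_⟩
  set β : intenseAut G := ⟨α, h.isIntense_involution hαα hα⟩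
  obtain ⟨x, y, hx, -⟩ := h.exists_pair
  have hl := apply_mul_inv_mem_pFrattini (p := p) β x
  rw [pFrattini_eq_commutator h.pow_mem_commutator] at hl
  have h1 := mul_mem (inv_mem hl) (hα x)
  have h2 : x ^ (((frattiniScalarHom p G β : ZMod p).val : ℤ) - (-1 : ℤ)) ∈ commutator G := by
    change (α x * _)⁻¹ * _ ∈ _ at h1
    rw [sub_neg_eq_add, zpow_add_one, zpow_natCast]
    convert h1 using 1
    group
  have h3 := (dvd_val_sub_iff _ _).mp (dvd_of_zpow_mem h.isPGroup hx h2)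
  exact Units.ext (by simpa using h3)

theorem IsClassThreeIndexSq.intensity_eq_two (h : IsClassThreeIndexSq p G) :
    intensity p G = 2 := by
  have hr : ((frattiniScalarHom p G).range : Set (ZMod p)ˣ) = {1, -1} := by
    ext m
    constructor
    · rintro ⟨α, rfl⟩
      exact h.frattiniScalarHom_eq α
    · rintro (rfl | rfl)
      · exact one_mem _
      · exact h.exists_frattiniScalarHom_eq_neg_one
  have hne : (1 : (ZMod p)ˣ) ≠ -1 := by
    intro e
    have e1 : (1 : ZMod p) = -1 := congrArg Units.val e
    apply h.not_dvd_two
    rw [← ZMod.intCast_zmod_eq_zero_iff_dvd]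
    push_cast
    linear_combination e1
  rw [intensity_eq_card_range, ← SetLike.coe_sort_coe, hr, Nat.card_coe_set_eq, Set.ncard_pair hne]

theorem odd_and_commutator_index_of_one_lt_intensity [Finite G] (hG : IsPGroup p G)
    (hB : gammaThree G ≤ Subgroup.center G) (hB0 : gammaThree G ≠ ⊥) (h : 1 < intensity p G) :
    Odd p ∧ (commutator G).index = p ^ 2 := by
  obtain ⟨α, hα⟩ : ∃ α, frattiniScalarHom p G α ≠ 1 := by
    by_contra! hc
    rw [intensity_eq_card_range, MonoidHom.range_eq_bot_iff.mpr (MonoidHom.ext hc)] at h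
    simp at h
  have hl := apply_mul_inv_mem_pFrattini (p := p) α
  have hl0 := not_dvd_val (frattiniScalarHom p G α)
  have hl1 : ¬ (p : ℤ) ∣ ((frattiniScalarHom p G α : ZMod p).val : ℤ) - 1 := by
    rw [dvd_val_sub_iff]
    exact fun e => hα (Units.ext (by simpa using e))
  refine ⟨(Fact.out : p.Prime).odd_of_ne_two ?_, ?_⟩
  -- For p = 2 one of l and l - 1 is even.
  · rintro rfl
    omega
  · have hne : commutator G ≠ ⊥ := fun e =>
      hB0 (le_bot_iff.mp (gammaThree_le_commutator.trans e.le))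
    have hpow := α.2.pow_mem_commutator hG hne hl hl0 hl1
    rw [pFrattini_eq_commutator hpow] at hl
    exact α.2.commutator_index hG hB hB0 hpow hl hl0 hl1

end

theorem theoremA4 (p : ℕ) [Fact p.Prime] (G : Type*) [Group G] [Finite G] (hG : IsPGroup p G)
    (hclass : Group.nilpotencyClass G = 3) :
    List.TFAE [
      1 < intensity p G,
      Odd p ∧ intensity p G = 2,
      Odd p ∧ (commutator G).index = p ^ 2] := by
  have : Group.IsNilpotent G := hG.isNilpotent
  -- The series is indexed from 0, with G itself as term 0.
  have hlcs : (⊤ : Subgroup G).lowerCentralSeries 2 = gammaThree G := by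
    rw [Subgroup.lowerCentralSeries_succ, Subgroup.top_lowerCentralSeries_one]
  have hB : gammaThree G ≤ Subgroup.center G := by
    rw [← Subgroup.commutator_top_right_eq_bot_iff_le_center, ← hlcs,
      ← Subgroup.lowerCentralSeries_succ, Subgroup.lowerCentralSeries_eq_bot_iff_nilpotencyClass_le]
    exact hclass.le
  have hB0 : gammaThree G ≠ ⊥ := by
    rw [← hlcs, Ne, Subgroup.lowerCentralSeries_eq_bot_iff_nilpotencyClass_le]
    omega
  tfae_have 1 → 3 := odd_and_commutator_index_of_one_lt_intensity hG hB hB0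
  tfae_have 3 → 2 := fun ⟨hp, hi⟩ =>
    ⟨hp, (IsClassThreeIndexSq.mk hG hp hB hB0 hi).intensity_eq_two⟩
  tfae_have 2 → 1 := fun ⟨_, h⟩ => by omega
  tfae_finish
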